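/- Let $(X,d)$ be a connected, locally compact metric space endowed with a non-zero positive Borel measure $\mu$ which is an inner regular Radon measure (that is, $\mu(S)=\sup\{\mu(Q): Q\subseteq S \text{ compact}\}$ for every Borel set $S$, and every point has a neighbourhood of finite measure) and satisfies $\operatorname{supp}\mu=X$. Denote by $B(x,\rho)$ the open balls, by $B(E,\rho)=\{x: d(x,E)<\rho\}$ the open neighbourhoods of a set $E$, and, for $\rho_0>0$, by $D_{\rho_0}$ the least element of $[1,+\infty]$ such that $\mu(B(x,2\rho))\leqslant D_{\rho_0}\,\mu(B(x,\rho))$ for every $x\in X$ and every $\rho\in(0,\rho_0]$. For $1<p\leqslant r\leqslant\infty$ set \[ \phi(r,p)=\inf_{q\in(1,p)}\Big(q'+\frac{1}{r/q-1}\Big)^{(1/p-1/r)/(1-q/r)},\qquad q'=\frac{q}{q-1} \] (with $1/\infty=q/\infty=0$ and $1/(\infty/q-1)=0$). For $S\subseteq X$ and a Banach space $B$, $\chi_S L^r(\mu;B)$ denotes the space of the $f\in L^r(\mu;B)$ that vanish $\mu$-almost everywhere outside $S$. Let $B_1,B_2$ be Banach spaces, $R>0$, $r\in(1,\infty]$,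 $E$ a $\mu$-measurable subset of $X$ with $\operatorname{diam}(E)<R$, \[ T\colon \chi_{B(E,R/2)}L^r(\mu;B_1)\to\chi_E L^r(\mu;B_2) \] a continuous linear map, and $K\colon E\times B(E,R/2)\to\mathcal L(B_1;B_2)$ a (strongly) $(\mu\otimes\mu)$-measurable map. Let $\kappa>2$ and assume that $D_{3\kappa R}<\infty$ and that the following hold: (i) for every open subset $F$ of $B(E,R/2)$, $K$ is $(\mu\otimes\mu)$-integrable on $(E\setminus F)\times F$, and, for every $f\in\chi_F L^\infty(\mu;B_1)$, \[ (Tf)(x)=\int_F K(x,y)f(y)\,\mathrm d\mu(y)\quad\text{for $\mu$-almost every } x\in E\setminus F; \] (ii) $A_R>0$ is such that $\|Tf\|_{L^r(\mu;B_2)}\leqslant A_R\|f\|_{L^r(\mu;B_1)}$ for every $f\in\chi_{B(E,R/2)}L^r(\mu;B_1)$; (iii) $C_R>0$ is such that \[ \int_{E\setminus B(y,2d(y,y'))}\|K(x,y)-K(x,y')\|\,\mathrm d\mu(x)\leqslant C_R \] for $\mu$-almost every $y,y'\in B(E,R/2)$ with $d(y,y')<R$. Then, for every $p\in(1,r]$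 and every $f\in\chi_E L^r(\mu;B_1)$, \[ \|Tf\|_{L^p(\mu;B_2)}\leqslant 16\,\phi(r,p)\,\big(D_{3\kappa R}^9A_R+C_R\big)\,\|f\|_{L^p(\mu;B_1)}. \] -/

import Mathlib

open MeasureTheory Metric Set
open scoped ENNReal

/-- The local doubling constant `D_R` of `μ`: the least `D ∈ [1, ∞]` with
`μ (B(x, 2ρ)) ≤ D μ (B(x, ρ))` for every point `x` and every `0 < ρ ≤ R` (open balls). -/
noncomputable def doublingConst {X : Type*} [MetricSpace X] [MeasurableSpace X]
    (μ : Measure X) (R : ℝ) : ℝ≥0∞ :=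
  sInf {D : ℝ≥0∞ | 1 ≤ D ∧
    ∀ (x : X) (ρ : ℝ), 0 < ρ → ρ ≤ R → μ (ball x (2 * ρ)) ≤ D * μ (ball x ρ)}

/-- `φ(r, p) = inf_{1 < q < p} (q' + 1 / (r / q - 1)) ^ ((1 / p - 1 / r) / (1 - q / r))`
for `1 < p ≤ r ≤ ∞`, where `q' = q / (q - 1)`.  The arithmetic of `[0, ∞]` supplies the
conventions for `r = ∞` and `p = ∞`; as `q < p ≤ r`, no subtraction is truncated. -/
noncomputable def interpConst (r p : ℝ≥0∞) : ℝ≥0∞ :=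
  ⨅ q ∈ Ioo 1 p, (q / (q - 1) + 1 / (r / q - 1)) ^ ((1 / p - 1 / r) / (1 - q / r)).toReal

/-- `χ_S L^r(μ; B)`: the classes in `L^r(μ; B)` that are concentrated on `S`. -/
def LpOn {X : Type*} [MeasurableSpace X] (B : Type*) [NormedAddCommGroup B] [NormedSpace ℝ B]
    (r : ℝ≥0∞) (μ : Measure X) (S : Set X) : Submodule ℝ (Lp B r μ) where
  carrier := {f | ∀ᵐ x ∂μ, x ∉ S → f x = 0}
  zero_mem' := by
    filter_upwards [Lp.coeFn_zero B r μ] with x hx _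
    exact hx
  add_mem' := by
    intro f g hf hg
    filter_upwards [hf, hg, Lp.coeFn_add f g] with x h1 h2 h3 hx
    refine h3.trans ?_
    simp [h1 hx, h2 hx]
  smul_mem' := by
    intro c f hf
    filter_upwards [hf, Lp.coeFn_smul c f] with x h1 h2 hx
    refine h2.trans ?_
    simp [h1 hx]

section Conditions

variable {X : Type*} [MetricSpace X] [MeasurableSpace X]
  {B₁ B₂ : Type*} [NormedAddCommGroup B₁] [NormedSpace ℝ B₁]
  [NormedAddCommGroup B₂] [NormedSpace ℝ B₂]

/-- Condition (i): off the diagonal, `T` is given by integration against the kernel `K`.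
For every open `F ⊆ B(E, R/2)`, `K` is integrable on `(E \ F) × F`, and
`T f (x) = ∫_F K(x, y) f(y) dμ(y)` for almost every `x ∈ E \ F`, whenever `f` is essentially
bounded and concentrated on `F`.  Here `B(E, R/2)` is the open `R/2`-neighbourhood of `E`. -/
def HasKernelOffDiagonal (μ : Measure X) (R : ℝ) (r : ℝ≥0∞) [Fact (1 ≤ r)] (E : Set X)
    (T : LpOn B₁ r μ (thickening (R / 2) E) →L[ℝ] LpOn B₂ r μ E)
    (K : X → X → B₁ →L[ℝ] B₂) : Prop :=
  ∀ F : Set X, IsOpen F → F ⊆ thickening (R / 2) E →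
    Integrable (Function.uncurry K) ((μ.restrict (E \ F)).prod (μ.restrict F)) ∧
    ∀ f : LpOn B₁ r μ (thickening (R / 2) E),
      MemLp (f : Lp B₁ r μ) ∞ μ → (f : Lp B₁ r μ) ∈ LpOn B₁ r μ F →
        ∀ᵐ x ∂μ.restrict (E \ F),
          (T f : Lp B₂ r μ) x = ∫ y in F, K x y ((f : Lp B₁ r μ) y) ∂μ

/-- Condition (iii): the integral Hörmander condition in the second variable,
`∫_{E \ B(y, 2 d(y, y'))} ‖K(x, y) - K(x, y')‖ dμ(x) ≤ C` for almost all
`y, y' ∈ B(E, R/2)` with `d(y, y') < R`. -/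
def HormanderCondition (μ : Measure X) (R : ℝ) (E : Set X)
    (K : X → X → B₁ →L[ℝ] B₂) (C : ℝ) : Prop :=
  ∀ᵐ y ∂μ.restrict (thickening (R / 2) E), ∀ᵐ y' ∂μ.restrict (thickening (R / 2) E),
    dist y y' < R →
      ∫⁻ x in E \ ball y (2 * dist y y'), ‖K x y - K x y'‖ₑ ∂μ ≤ ENNReal.ofReal C

end Conditions

/-!
The operator satisfies a weak type `(1, 1)` estimate with constant `4 (D ^ 9 A + C)` on bounded
functions on `E`, and the `L^p` bound follows by real interpolation with the `L^r` bound.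

**Weak type.** Doubling up to a scale beyond `4 R` makes balls of that size finite and, together with
connectedness, makes `X` second countable, so that Lebesgue's differentiation theorem and Tonelli's
theorem are available. To estimate `|T f| > t`, let `γ` be proportional to `D ^ 5 t / (D ^ 9 A + C)`.
If a ball of radius comparable to `R` centred in `E` has average above `γ`, then `μ E` is already
small enough. Otherwise all balls with average above `γ` are small, and stopping times and Vitali's
lemma produce disjoint sets `Q i` that play the role of dyadic cubes
(`measure_le_or_nonempty_czCovering`). The good part (averages on the `Q i`) is at most `D ^ 2 γ` and
is handled by the `L^r` bound (`mul_measure_lt_enorm_le_of_bounded`). The bad part has mean zero on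
each `Q i`, so off the enlarged balls the kernel may be replaced by its oscillation, and the
Hörmander condition bounds the integral (`lintegral_enorm_integral_badPart_le`). This gives
`mul_measure_lt_enorm_apply_le`.

**Interpolation.** For `1 < q < p`, Marcinkiewicz interpolation gives the `L^q` bound with constant
`8 (D ^ 9 A + C) (q' + 1 / (r / q - 1)) ^ (1 / q)`. To pass from `L^q` and `L^r` to `L^p` one compares,
at every level `σ`, the integrals of `min ((u / σ) ^ q) ((u / σ) ^ r)` for `u = |T f|` and `u = |f|`,
and integrates against a power of `σ`. The same integral in `σ` appears on both sides and cancels, so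
that, as in the Riesz–Thorin theorem, the constant is the geometric mean of the endpoint constants,
up to a factor `2`; no complexification of the Banach spaces is needed. For `r = ∞` the part of `T f`
below the level `σ` is dropped, since the small part of a truncation is mapped below `σ / 2`. Both interpolations are
instances of `lintegral_rpow_le_of_levels`. Functions in `L^r` that are not bounded are reached by
truncation.
-/

/-! ### Doubling measures at a bounded scale -/

section Doubling

open Filter
open scoped Topology

variable {X : Type*} [MetricSpace X] [MeasurableSpace X] {μ : Measure X} {L : ℝ}

theorem one_le_doublingConst : 1 ≤ doublingConst μ L :=
  le_sInf fun _ h => h.1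

/-- The infimum that defines the doubling constant is attained. -/
theorem measure_ball_two_mul_le (hD : doublingConst μ L < ∞) (x : X) {ρ : ℝ} (h0 : 0 < ρ)
    (hρ : ρ ≤ L) : μ (ball x (2 * ρ)) ≤ doublingConst μ L * μ (ball x ρ) := by
  obtain ⟨D₀, hD₀, -⟩ := sInf_lt_iff.1 hD
  rcases eq_or_ne (μ (ball x ρ)) 0 with hm | hm
  · simpa [hm] using hD₀.2 x ρ h0 hρ
  rcases eq_or_ne (μ (ball x ρ)) ∞ with hm' | hm'
  · rw [hm', ENNReal.mul_top (zero_lt_one.trans_le one_le_doublingConst).ne']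
    exact le_top
  rw [← ENNReal.div_le_iff hm hm']
  exact le_sInf fun D hD => (ENNReal.div_le_iff hm hm').2 (hD.2 x ρ h0 hρ)

theorem measure_ball_two_pow_mul_le (hD : doublingConst μ L < ∞) (x : X) {ρ : ℝ} (h0 : 0 < ρ)
    (n : ℕ) (hρ : 2 ^ n * ρ ≤ 2 * L) :
    μ (ball x (2 ^ n * ρ)) ≤ doublingConst μ L ^ n * μ (ball x ρ) := by
  induction n with
  | zero => simp
  | succ n ih =>
    have h1 : 2 ^ n * ρ ≤ L := by rw [pow_succ] at hρ; linarith
    have h2 : 0 < 2 ^ n * ρ := by positivity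
    calc μ (ball x (2 ^ (n + 1) * ρ)) = μ (ball x (2 * (2 ^ n * ρ))) := by ring_nf
      _ ≤ doublingConst μ L * μ (ball x (2 ^ n * ρ)) := measure_ball_two_mul_le hD x h2 h1
      _ ≤ doublingConst μ L * (doublingConst μ L ^ n * μ (ball x ρ)) := by
        gcongr; exact ih (by linarith)
      _ = doublingConst μ L ^ (n + 1) * μ (ball x ρ) := by ring

/-- Local finiteness at a point spreads, by doubling, to the balls up to twice the doubling
scale. -/
theorem measure_ball_lt_top_of_doubling [IsLocallyFiniteMeasure μ] (hL : 0 < L)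
    (hD : doublingConst μ L < ∞) (x : X) : μ (ball x (2 * L)) < ∞ := by
  obtain ⟨ε, hε, hfin⟩ : ∃ ε > 0, μ (ball x ε) < ∞ := by
    obtain ⟨s, hs, hμ⟩ := μ.finiteAt_nhds x
    obtain ⟨ε, hε, hsub⟩ := Metric.mem_nhds_iff.1 hs
    exact ⟨ε, hε, (measure_mono hsub).trans_lt hμ⟩
  obtain ⟨n, hn⟩ := pow_unbounded_of_one_lt (2 * L / ε) one_lt_two
  have hpos : (0 : ℝ) < 2 ^ n := by positivity
  have hle : 2 * L / 2 ^ n ≤ ε := by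
    rw [div_le_iff₀ hpos]; rw [div_lt_iff₀ hε] at hn; linarith
  have h := measure_ball_two_pow_mul_le hD x (ρ := 2 * L / 2 ^ n) (by positivity) n
    (by rw [mul_div_cancel₀ _ hpos.ne'])
  rw [mul_div_cancel₀ _ hpos.ne'] at h
  exact h.trans_lt (ENNReal.mul_lt_top (ENNReal.pow_lt_top hD)
    ((measure_mono (ball_subset_ball hle)).trans_lt hfin))

theorem measure_closedBall_two_pow_mul_le [OpensMeasurableSpace X] [IsLocallyFiniteMeasure μ]
    (hD : doublingConst μ L < ∞) (x : X) {ρ : ℝ} (h0 : 0 < ρ) (n : ℕ) (hρ : 2 ^ n * ρ < 2 * L) :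
    μ (closedBall x (2 ^ n * ρ)) ≤ doublingConst μ L ^ n * μ (closedBall x ρ) := by
  have hpos : (0 : ℝ) < 2 ^ n := by positivity
  have hone : (1 : ℝ) ≤ 2 ^ n := one_le_pow₀ one_le_two
  have hL : 0 < L := by nlinarith [mul_pos hpos h0]
  have hlt : ρ < 2 * L / 2 ^ n := by rw [lt_div_iff₀ hpos]; linarith
  have hlim : Tendsto (μ ∘ fun r => ball x r) (𝓝[>] ρ) (𝓝 (μ (closedBall x ρ))) := by
    rw [← biInter_gt_ball]
    refine tendsto_measure_biInter_gt (fun r _ => isOpen_ball.nullMeasurableSet)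
      (fun i j _ hij => ball_subset_ball hij) ⟨2 * L / 2 ^ n, hlt, ?_⟩
    refine ((measure_mono (ball_subset_ball ?_)).trans_lt
      (measure_ball_lt_top_of_doubling hL hD x)).ne
    exact div_le_self (by positivity) hone
  refine ge_of_tendsto
    (ENNReal.Tendsto.const_mul hlim (Or.inr (ENNReal.pow_lt_top hD).ne)) ?_
  filter_upwards [Ioo_mem_nhdsGT hlt] with r hr
  have hr2 : 2 ^ n * r < 2 * L := by
    have := hr.2; rw [lt_div_iff₀ hpos] at this; linarith
  refine (measure_mono (closedBall_subset_ball ?_)).trans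
    (measure_ball_two_pow_mul_le hD x (h0.trans hr.1) n hr2.le)
  exact mul_lt_mul_of_pos_left hr.1 hpos

theorem isUnifLocDoublingMeasure_of_doublingConst_lt_top [OpensMeasurableSpace X]
    [IsLocallyFiniteMeasure μ] (hL : 0 < L) (hD : doublingConst μ L < ∞) :
    IsUnifLocDoublingMeasure μ := by
  refine ⟨(doublingConst μ L).toNNReal, ?_⟩
  filter_upwards [Ioo_mem_nhdsGT hL] with ε hε x
  rw [ENNReal.coe_toNNReal hD.ne]
  simpa using measure_closedBall_two_pow_mul_le hD x hε.1 1 (by linarith [hε.2])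

/-- A set that lies well inside a set of finite measure is separable when `μ` charges open sets:
disjoint balls of a fixed radius have positive measure, so a maximal family of them is
countable. -/
theorem isSeparable_of_ball_subset [OpensMeasurableSpace X] [μ.IsOpenPosMeasure] {s t : Set X}
    {δ : ℝ} (hδ : 0 < δ) (hst : ∀ x ∈ s, ball x δ ⊆ t) (ht : μ t ≠ ∞) :
    TopologicalSpace.IsSeparable s := by
  have key : ∀ ε : ℝ≥0∞, 0 < ε → ∃ v : Set X, v.Countable ∧ s ⊆ ⋃ x ∈ v, closedEBall x ε := by
    intro ε hε
    obtain ⟨η, hη0, hηδ, hηε⟩ : ∃ η : ℝ, 0 < η ∧ η ≤ δ ∧ ENNReal.ofReal (4 * η) ≤ ε := by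
      rcases eq_or_ne ε ∞ with rfl | hε'
      · exact ⟨δ, hδ, le_rfl, le_top⟩
      · have : 0 < ε.toReal := ENNReal.toReal_pos hε.ne' hε'
        refine ⟨min δ (ε.toReal / 4), lt_min hδ (by positivity), min_le_left _ _, ?_⟩
        rw [ENNReal.ofReal_le_iff_le_toReal hε']
        linarith [min_le_right δ (ε.toReal / 4)]
    obtain ⟨u, hus, hdisj, hcov⟩ := Vitali.exists_disjoint_subfamily_covering_enlargement_ball
      s id (fun _ => η) η (fun _ _ => le_rfl) 4 (by norm_num)
    refine ⟨u, ?_, ?_⟩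
    · have hc : {i : u | 0 < μ (ball (i : X) η)}.Countable := by
        refine Measure.countable_meas_pos_of_disjoint_of_meas_iUnion_ne_top
          (As := fun i : u => ball (i : X) η) μ (fun _ => measurableSet_ball) ?_ ?_
        · intro i j hij
          exact hdisj i.2 j.2 (fun h => hij (Subtype.ext h))
        · refine ne_top_of_le_ne_top ht (measure_mono (iUnion_subset fun i => ?_))
          exact (ball_subset_ball hηδ).trans (hst _ (hus i.2))
      have : {i : u | 0 < μ (ball (i : X) η)} = univ :=
        eq_univ_of_forall fun i => measure_ball_pos μ _ hη0
      rw [this, countable_univ_iff] at hc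
      exact Set.countable_coe_iff.1 hc
    · intro x hx
      obtain ⟨b, hb, hsub⟩ := hcov x hx
      refine mem_iUnion₂.2 ⟨b, hb, ?_⟩
      have h1 : x ∈ ball b (4 * η) := hsub (mem_ball_self hη0)
      rw [mem_closedEBall, edist_dist]
      exact (ENNReal.ofReal_le_ofReal (mem_ball.1 h1).le).trans hηε
  obtain ⟨v, -, hv, hsv⟩ := EMetric.subset_countable_closure_of_almost_dense_set s key
  exact ⟨v, hv, hsv⟩

/-- A connected metric space whose balls of some fixed radius have finite measure is second
countable. -/
theorem secondCountableTopology_of_measure_ball_lt_top [ConnectedSpace X]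
    [OpensMeasurableSpace X] [μ.IsOpenPosMeasure] (hL : 0 < L)
    (hfin : ∀ x, μ (ball x (2 * L)) < ∞) : SecondCountableTopology X := by
  have hsep : ∀ x, TopologicalSpace.IsSeparable (ball x L) := fun x =>
    isSeparable_of_ball_subset (t := ball x (2 * L)) hL
      (fun y hy => ball_subset_ball' (by linarith [mem_ball.1 hy])) (hfin x).ne
  obtain ⟨x₀⟩ := (inferInstance : Nonempty X)
  let S : ℕ → Set X := fun n => Nat.rec {x₀} (fun _ s => ⋃ x ∈ s, ball x (L / 2)) n
  have hS : ∀ n, S (n + 1) = ⋃ x ∈ S n, ball x (L / 2) := fun n => rfl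
  have hSsep : ∀ n, TopologicalSpace.IsSeparable (S n) := by
    intro n
    induction n with
    | zero => exact (countable_singleton x₀).isSeparable
    | succ n ih =>
      obtain ⟨c, hc, hcl⟩ := ih
      have : TopologicalSpace.IsSeparable (⋃ x : c, ball (x : X) L) := by
        have := hc.to_subtype
        exact .iUnion fun x => hsep x
      refine this.mono ?_
      rw [hS]
      refine iUnion₂_subset fun x hx y hy => ?_
      obtain ⟨z, hz, hxz⟩ := Metric.mem_closure_iff.1 (hcl hx) (L / 2) (by positivity)
      refine mem_iUnion.2 ⟨⟨z, hz⟩, ?_⟩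
      have := mem_ball.1 hy
      exact mem_ball.2 (by linarith [dist_triangle y x z])
  have huniv : (⋃ n, S n) = univ := by
    have hle : ∀ n, S n ⊆ S (n + 1) := fun n x hx => by
      rw [hS]
      exact mem_iUnion₂.2 ⟨x, hx, mem_ball_self (by positivity)⟩
    refine IsClopen.eq_univ ⟨?_, ?_⟩ ⟨x₀, mem_iUnion.2 ⟨0, rfl⟩⟩
    · refine isClosed_of_closure_subset fun y hy => ?_
      obtain ⟨z, hz, hyz⟩ := Metric.mem_closure_iff.1 hy (L / 2) (by positivity)
      obtain ⟨n, hn⟩ := mem_iUnion.1 hz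
      exact mem_iUnion.2 ⟨n + 1, by rw [hS]; exact mem_iUnion₂.2 ⟨z, hn, hyz⟩⟩
    · have : (⋃ n, S n) = ⋃ n, S (n + 1) :=
        (iUnion_mono hle).antisymm (iUnion_subset fun n => subset_iUnion S (n + 1))
      rw [this]
      exact isOpen_iUnion fun n => by
        rw [hS]; exact isOpen_biUnion fun _ _ => isOpen_ball
  have : TopologicalSpace.SeparableSpace X :=
    TopologicalSpace.isSeparable_univ_iff.1 (huniv ▸ TopologicalSpace.IsSeparable.iUnion hSsep)
  exact UniformSpace.secondCountable_of_separable X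

end Doubling

/-! ### Calderón–Zygmund coverings -/

section Covering

open Filter
open scoped Topology

/-- Countably many disjoint sets `B i`, contained in sets `P i`, can be enlarged to disjoint sets
`Q i`, still contained in `P i`, that together exhaust the union of the `P i`. -/
theorem exists_disjoint_between {X ι : Type*} [MeasurableSpace X] [Countable ι]
    {B P : ι → Set X} (hB : ∀ i, MeasurableSet (B i)) (hP : ∀ i, MeasurableSet (P i))
    (hBP : ∀ i, B i ⊆ P i) (hdisj : Pairwise (Function.onFun Disjoint B)) :
    ∃ Q : ι → Set X, (∀ i, MeasurableSet (Q i)) ∧ (∀ i, B i ⊆ Q i) ∧ (∀ i, Q i ⊆ P i) ∧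
      Pairwise (Function.onFun Disjoint Q) ∧ ⋃ i, Q i = ⋃ i, P i := by
  obtain ⟨e, he⟩ := exists_injective_nat ι
  refine ⟨fun i => B i ∪ (P i \ ((⋃ j, B j) ∪ ⋃ j, ⋃ (_ : e j < e i), P j)), fun i => ?_,
    fun i => subset_union_left, fun i => union_subset (hBP i) sdiff_subset, ?_, ?_⟩
  · exact (hB i).union ((hP i).diff ((MeasurableSet.iUnion hB).union
      (MeasurableSet.iUnion fun j => MeasurableSet.iUnion fun _ => hP j)))
  · intro i j hij
    refine Set.disjoint_left.2 ?_
    rintro x (hx | ⟨hx, hx'⟩) (hy | ⟨hy, hy'⟩)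
    · exact Set.disjoint_left.1 (hdisj hij) hx hy
    · exact hy' (Or.inl (mem_iUnion.2 ⟨i, hx⟩))
    · exact hx' (Or.inl (mem_iUnion.2 ⟨j, hy⟩))
    · rcases lt_trichotomy (e i) (e j) with h | h | h
      · exact hy' (Or.inr (mem_iUnion₂.2 ⟨i, h, hx⟩))
      · exact hij (he h)
      · exact hx' (Or.inr (mem_iUnion₂.2 ⟨j, h, hy⟩))
  · refine (iUnion_mono fun i => union_subset (hBP i) sdiff_subset).antisymm ?_
    intro x hx
    by_cases hxB : ∃ j, x ∈ B j
    · obtain ⟨j, hj⟩ := hxB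
      exact mem_iUnion.2 ⟨j, Or.inl hj⟩
    · classical
      have hex : ∃ n, ∃ i, e i = n ∧ x ∈ P i := by
        obtain ⟨i, hi⟩ := mem_iUnion.1 hx
        exact ⟨e i, i, rfl, hi⟩
      obtain ⟨i, hi, hxi⟩ := Nat.find_spec hex
      refine mem_iUnion.2 ⟨i, Or.inr ⟨hxi, ?_⟩⟩
      rintro (h | h)
      · exact hxB (mem_iUnion.1 h)
      · obtain ⟨j, hj, hxj⟩ := mem_iUnion₂.1 h
        exact Nat.find_min hex (hi ▸ hj) ⟨j, rfl, hxj⟩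

variable {X : Type*} [MetricSpace X] [MeasurableSpace X]

/-- A Calderón–Zygmund covering for the density `a` on `E` at height `γ`: closed balls
`B(c i, ρ i)` with centres in `E` and radii below `R / 32`, together with disjoint sets `Q i`
inside the fourfold balls, such that `a` is at most `γ` off the `Q i`, averages to at most
`D ^ 2 γ` over each `Q i`, and the balls enlarged 32 times have total measure at most
`D ^ 5 γ⁻¹ ∫ a`. -/
structure CZCovering (μ : Measure X) (D : ℝ≥0∞) (R : ℝ) (E : Set X) (a : X → ℝ≥0∞)
    (γ : ℝ≥0∞) where
  /-- The index type. -/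
  ι : Type
  countable : Countable ι
  /-- The centres of the balls. -/
  c : ι → X
  /-- The radii of the balls. -/
  ρ : ι → ℝ
  /-- The disjoint pieces that replace dyadic cubes. -/
  Q : ι → Set X
  c_mem : ∀ i, c i ∈ E
  ρ_pos : ∀ i, 0 < ρ i
  ρ_lt : ∀ i, ρ i < R / 32
  measurableSet_Q : ∀ i, MeasurableSet (Q i)
  disjoint_Q : Pairwise (Function.onFun Disjoint Q)
  Q_subset : ∀ i, Q i ⊆ closedBall (c i) (4 * ρ i)
  measure_Q_ne_zero : ∀ i, μ (Q i) ≠ 0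
  lintegral_Q_le : ∀ i, ∫⁻ x in Q i, a x ∂μ ≤ γ * D ^ 2 * μ (Q i)
  measure_enlarged_le : γ * μ (⋃ i, closedBall (c i) (32 * ρ i)) ≤ D ^ 5 * ∫⁻ x, a x ∂μ
  ae_le : ∀ᵐ x ∂μ, x ∈ E → x ∉ ⋃ i, Q i → a x ≤ γ

/-- Lebesgue differentiation: where `a` exceeds `γ`, so do its averages over small balls. -/
theorem ae_exists_lt_lintegral_closedBall [BorelSpace X] [SecondCountableTopology X]
    (μ : Measure X) [IsLocallyFiniteMeasure μ] [μ.IsOpenPosMeasure] [IsUnifLocDoublingMeasure μ]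
    {a : X → ℝ≥0∞} (ha : AEMeasurable a μ) (hfin : ∫⁻ x, a x ∂μ ≠ ∞) (γ : ℝ≥0∞) {δ : ℝ}
    (hδ : 0 < δ) :
    ∀ᵐ x ∂μ, γ < a x →
      ∃ ρ, 0 < ρ ∧ ρ < δ ∧ γ * μ (closedBall x ρ) < ∫⁻ y in closedBall x ρ, a y ∂μ := by
  filter_upwards [(IsUnifLocDoublingMeasure.vitaliFamily μ 1).ae_tendsto_lintegral_div ha hfin]
    with x hx hγ
  have hcb := IsUnifLocDoublingMeasure.tendsto_closedBall_filterAt μ (K := 1) (x := x)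
    (l := 𝓝[>] (0 : ℝ)) (fun _ => x) id tendsto_id (by
      filter_upwards [self_mem_nhdsWithin] with r hr
      exact mem_closedBall_self (by simpa using (le_of_lt hr)))
  obtain ⟨U, hU, hUfin⟩ := μ.finiteAt_nhds x
  obtain ⟨ε, hε, hsub⟩ := Metric.nhds_basis_closedBall.mem_iff.1 hU
  have h1 := (hx.comp hcb).eventually (lt_mem_nhds hγ)
  have h2 : ∀ᶠ r in 𝓝[>] (0 : ℝ), r ∈ Ioo 0 (min δ ε) := Ioo_mem_nhdsGT (lt_min hδ hε)
  obtain ⟨ρ, hρ1, hρ2⟩ := (h1.and h2).exists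
  refine ⟨ρ, hρ2.1, hρ2.2.trans_le (min_le_left _ _), ?_⟩
  refine (ENNReal.lt_div_iff_mul_lt (Or.inl (measure_closedBall_pos μ _ hρ2.1).ne')
    (Or.inl (ne_of_lt ?_))).1 hρ1
  exact (measure_mono ((closedBall_subset_closedBall
    (hρ2.2.le.trans (min_le_right _ _))).trans hsub)).trans_lt hUfin

/-- Either `E` itself has measure at most `D ^ 5 γ⁻¹ ∫ a`, or there is a Calderón–Zygmund covering
at height `γ`.  The first case occurs when some ball of radius comparable to `R` has average above
`γ`; otherwise every radius at which the average exceeds `γ` is below `R / 32`, and a nearly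
maximal one can be selected at each point. -/
theorem measure_le_or_nonempty_czCovering [BorelSpace X] [SecondCountableTopology X]
    (μ : Measure X) [IsLocallyFiniteMeasure μ] [μ.IsOpenPosMeasure] [IsUnifLocDoublingMeasure μ]
    {D : ℝ≥0∞} {R : ℝ} (hR : 0 < R)
    (hdb : ∀ (x : X) (ρ : ℝ) (n : ℕ), 0 < ρ → 2 ^ n * ρ ≤ 4 * R →
      μ (closedBall x (2 ^ n * ρ)) ≤ D ^ n * μ (closedBall x ρ))
    {E : Set X} (hE : ∀ x ∈ E, ∀ y ∈ E, dist x y ≤ R)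
    {a : X → ℝ≥0∞} (ha : AEMeasurable a μ) (hfin : ∫⁻ x, a x ∂μ ≠ ∞)
    {γ : ℝ≥0∞} :
    γ * μ E ≤ D ^ 5 * ∫⁻ x, a x ∂μ ∨ Nonempty (CZCovering μ D R E a γ) := by
  by_cases hbig : ∃ x ∈ E, ∃ ρ, R / 32 ≤ ρ ∧ ρ ≤ R / 8 ∧
      γ * μ (closedBall x ρ) < ∫⁻ y in closedBall x ρ, a y ∂μ
  · obtain ⟨x, hx, ρ, hρ1, hρ2, hρ⟩ := hbig
    left
    have hsub : E ⊆ closedBall x (2 ^ 5 * ρ) := fun y hy => by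
      rw [mem_closedBall]
      linarith [hE y hy x hx]
    calc γ * μ E ≤ γ * (D ^ 5 * μ (closedBall x ρ)) := by
          gcongr
          exact (measure_mono hsub).trans (hdb x ρ 5 (by linarith) (by linarith))
      _ = D ^ 5 * (γ * μ (closedBall x ρ)) := by ring
      _ ≤ D ^ 5 * ∫⁻ y in closedBall x ρ, a y ∂μ := by gcongr
      _ ≤ D ^ 5 * ∫⁻ x, a x ∂μ := by gcongr; exact Measure.restrict_le_self
  right
  push Not at hbig
  let bad : X → Set ℝ := fun x =>
    {ρ | 0 < ρ ∧ ρ < R / 32 ∧ γ * μ (closedBall x ρ) < ∫⁻ y in closedBall x ρ, a y ∂μ}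
  let t : Set X := {x ∈ E | (bad x).Nonempty}
  have hsel : ∀ x : X, ∃ ρ, x ∈ t → ρ ∈ bad x ∧ ∀ s, 2 * ρ ≤ s → s ≤ R / 8 →
      ∫⁻ y in closedBall x s, a y ∂μ ≤ γ * μ (closedBall x s) := by
    intro x
    by_cases hx : x ∈ t
    swap
    · exact ⟨0, fun h => absurd h hx⟩
    have hbdd : BddAbove (bad x) := ⟨R / 32, fun ρ h => h.2.1.le⟩
    have hpos : 0 < sSup (bad x) := by
      obtain ⟨ρ, hρ⟩ := hx.2
      exact hρ.1.trans_le (le_csSup hbdd hρ)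
    obtain ⟨ρ, hρ, hlt⟩ := exists_lt_of_lt_csSup hx.2 (half_lt_self hpos)
    refine ⟨ρ, fun _ => ⟨hρ, fun s hs1 hs2 => ?_⟩⟩
    rcases le_or_gt (R / 32) s with h | h
    · exact hbig x hx.1 s h hs2
    · by_contra hcon
      have : s ∈ bad x := ⟨by linarith [hρ.1], h, not_le.1 hcon⟩
      linarith [le_csSup hbdd this]
  choose ρ hρ using hsel
  obtain ⟨u, hut, hdisj, hcov⟩ :=
    Vitali.exists_disjoint_subfamily_covering_enlargement_closedBall t id ρ (R / 32)
      (fun x hx => (hρ x hx).1.2.1.le) 4 (by norm_num)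
  have hpos : ∀ x ∈ u, 0 < ρ x := fun x hx => (hρ x (hut hx)).1.1
  have hlt : ∀ x ∈ u, ρ x < R / 32 := fun x hx => (hρ x (hut hx)).1.2.1
  have hu : u.Countable := hdisj.countable_of_nonempty_interior fun x hx =>
    (nonempty_ball.2 (hpos x hx)).mono ball_subset_interior_closedBall
  -- The covering is indexed by natural numbers, so that its index type lives in `Type`.
  obtain ⟨e, he⟩ := (countable_coe_iff.2 hu).exists_injective_nat'
  let ι : Type := range e
  let c : ι → u := fun i => i.2.choose
  have hc : Function.Injective c := by
    intro i j hij
    refine Subtype.ext ?_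
    rw [← i.2.choose_spec, ← j.2.choose_spec]
    exact congrArg e hij
  have hcs : ∀ x ∈ u, ∃ i, (c i : X) = x := fun x hx =>
    ⟨⟨e ⟨x, hx⟩, mem_range_self _⟩, by
      exact congrArg Subtype.val (he (Exists.choose_spec (p := fun y => e y = e ⟨x, hx⟩) _))⟩
  have hdisj' : Pairwise (Function.onFun Disjoint fun i => closedBall (c i : X) (ρ (c i))) :=
    fun i j hij => hdisj (c i).2 (c j).2 fun h => hij (hc (Subtype.ext h))
  obtain ⟨Q, hQm, hBQ, hQP, hQd, hQU⟩ := exists_disjoint_between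
    (B := fun i => closedBall (c i : X) (ρ (c i)))
    (P := fun i => closedBall (c i : X) (4 * ρ (c i)))
    (fun _ => measurableSet_closedBall) (fun _ => measurableSet_closedBall)
    (fun i => closedBall_subset_closedBall (by linarith [hpos _ (c i).2])) hdisj'
  refine ⟨⟨ι, inferInstance, fun i => c i, fun i => ρ (c i), Q, fun i => (hut (c i).2).1,
    fun i => hpos _ (c i).2, fun i => hlt _ (c i).2, hQm, hQd, hQP, fun i => ?_, fun i => ?_,
    ?_, ?_⟩⟩
  · exact ((measure_closedBall_pos μ _ (hpos _ (c i).2)).trans_le (measure_mono (hBQ i))).ne'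
  · have h1 := hpos _ (c i).2
    have h2 := hlt _ (c i).2
    have h3 := hdb (c i) (ρ (c i)) 2 h1 (by linarith)
    norm_num at h3
    calc ∫⁻ x in Q i, a x ∂μ ≤ ∫⁻ x in closedBall (c i) (4 * ρ (c i)), a x ∂μ :=
          lintegral_mono_set (hQP i)
      _ ≤ γ * μ (closedBall (c i) (4 * ρ (c i))) :=
          (hρ _ (hut (c i).2)).2 _ (by linarith) (by linarith)
      _ ≤ γ * (D ^ 2 * μ (Q i)) := by
          gcongr
          exact h3.trans (by gcongr; exact hBQ i)
      _ = γ * D ^ 2 * μ (Q i) := by ring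
  · calc γ * μ (⋃ i, closedBall (c i : X) (32 * ρ (c i)))
        ≤ γ * ∑' i, μ (closedBall (c i : X) (32 * ρ (c i))) := by
          gcongr; exact measure_iUnion_le _
      _ ≤ γ * ∑' i, D ^ 5 * μ (closedBall (c i : X) (ρ (c i))) := by
          gcongr with i
          have h3 := hdb (c i) (ρ (c i)) 5 (hpos _ (c i).2) (by linarith [hlt _ (c i).2])
          norm_num at h3
          exact h3
      _ = D ^ 5 * ∑' i, γ * μ (closedBall (c i : X) (ρ (c i))) := by
          rw [ENNReal.tsum_mul_left, ENNReal.tsum_mul_left]; ring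
      _ ≤ D ^ 5 * ∑' i, ∫⁻ x in closedBall (c i : X) (ρ (c i)), a x ∂μ := by
          gcongr with i
          exact (hρ _ (hut (c i).2)).1.2.2.le
      _ = D ^ 5 * ∫⁻ x in ⋃ i, closedBall (c i : X) (ρ (c i)), a x ∂μ := by
          rw [lintegral_iUnion (fun _ => measurableSet_closedBall) hdisj']
      _ ≤ D ^ 5 * ∫⁻ x, a x ∂μ := by gcongr; exact Measure.restrict_le_self
  · filter_upwards [ae_exists_lt_lintegral_closedBall μ ha hfin γ (δ := R / 32) (by positivity)]
      with x hx hxE hxQ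
    by_contra hcon
    obtain ⟨b, hb, hsub⟩ := hcov x ⟨hxE, hx (not_le.1 hcon)⟩
    obtain ⟨i, hi⟩ := hcs b hb
    refine hxQ ?_
    rw [hQU]
    refine mem_iUnion.2 ⟨i, ?_⟩
    rw [hi]
    exact hsub (mem_closedBall_self (hρ x ⟨hxE, hx (not_le.1 hcon)⟩).1.1.le)

end Covering

/-! ### Good and bad parts -/

section GoodPart

variable {X : Type*} [MeasurableSpace X] {μ : Measure X} {ι : Type*} {Q : ι → Set X}
  {B : Type*} [NormedAddCommGroup B] [NormedSpace ℝ B]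

theorem enorm_average_le {ν : Measure X} (f : X → B) :
    ‖⨍ y, f y ∂ν‖ₑ ≤ (ν univ)⁻¹ * ∫⁻ y, ‖f y‖ₑ ∂ν := by
  rw [average]
  refine (enorm_integral_le_lintegral_enorm _).trans ?_
  rw [lintegral_smul_measure, smul_eq_mul]

theorem measure_mul_enorm_setAverage_le {s : Set X} (f : X → B) :
    μ s * ‖⨍ y in s, f y ∂μ‖ₑ ≤ ∫⁻ y in s, ‖f y‖ₑ ∂μ := by
  refine (mul_le_mul_right (enorm_average_le _) _).trans ?_
  rw [Measure.restrict_apply_univ, ← mul_assoc]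
  exact (mul_le_mul_left (ENNReal.mul_inv_le_one _) _).trans_eq (one_mul _)

open Classical in
/-- The good part of `f` relative to disjoint sets `Q i`: the average of `f` over `Q i` on `Q i`,
and `f` off the union of the `Q i`. -/
noncomputable def goodPart (μ : Measure X) (Q : ι → Set X) (f : X → B) (x : X) : B :=
  if h : ∃ i, x ∈ Q i then ⨍ y in Q h.choose, f y ∂μ else f x

theorem goodPart_of_mem (hQ : Pairwise (Function.onFun Disjoint Q)) (f : X → B) {i : ι} {x : X}
    (hx : x ∈ Q i) : goodPart μ Q f x = ⨍ y in Q i, f y ∂μ := by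
  have h : ∃ i, x ∈ Q i := ⟨i, hx⟩
  have hi : h.choose = i := by
    by_contra hne
    exact Set.disjoint_left.1 (hQ hne) h.choose_spec hx
  rw [goodPart, dif_pos h, hi]

theorem goodPart_of_notMem (f : X → B) {x : X} (hx : x ∉ ⋃ i, Q i) :
    goodPart μ Q f x = f x := by
  rw [goodPart, dif_neg (by simpa using hx)]

theorem aestronglyMeasurable_goodPart [Countable ι] (hQm : ∀ i, MeasurableSet (Q i))
    (hQ : Pairwise (Function.onFun Disjoint Q)) {f : X → B} (hf : AEStronglyMeasurable f μ) :
    AEStronglyMeasurable (goodPart μ Q f) μ := by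
  have hU : MeasurableSet (⋃ i, Q i) := .iUnion hQm
  rw [← Measure.restrict_univ (μ := μ), ← union_compl_self (⋃ i, Q i),
    aestronglyMeasurable_union_iff, aestronglyMeasurable_iUnion_iff]
  refine ⟨fun i => ?_, ?_⟩
  · refine (aestronglyMeasurable_const (b := ⨍ y in Q i, f y ∂μ)).congr ?_
    filter_upwards [ae_restrict_mem (hQm i)] with x hx
    rw [union_compl_self, Measure.restrict_univ, goodPart_of_mem hQ f hx]
  · refine hf.restrict.congr ?_
    filter_upwards [ae_restrict_mem hU.compl] with x hx
    rw [union_compl_self, Measure.restrict_univ, goodPart_of_notMem f hx]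

theorem lintegral_enorm_goodPart_le [Countable ι] (hQm : ∀ i, MeasurableSet (Q i))
    (hQ : Pairwise (Function.onFun Disjoint Q)) (f : X → B) :
    ∫⁻ x, ‖goodPart μ Q f x‖ₑ ∂μ ≤ ∫⁻ x, ‖f x‖ₑ ∂μ := by
  have hU : MeasurableSet (⋃ i, Q i) := .iUnion hQm
  rw [← lintegral_add_compl (fun x => ‖goodPart μ Q f x‖ₑ) hU,
    ← lintegral_add_compl (fun x => ‖f x‖ₑ) hU, lintegral_iUnion hQm hQ, lintegral_iUnion hQm hQ]
  refine add_le_add (ENNReal.tsum_le_tsum fun i => ?_) (le_of_eq ?_)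
  · rw [setLIntegral_congr_fun (g := fun _ => ‖⨍ y in Q i, f y ∂μ‖ₑ) (hQm i)
      (fun x hx => by simp only [goodPart_of_mem hQ f hx]), setLIntegral_const, mul_comm]
    exact measure_mul_enorm_setAverage_le f
  · exact setLIntegral_congr_fun hU.compl fun x hx => by simp only [goodPart_of_notMem f hx]

end GoodPart

/-! ### The kernel against functions of mean zero -/

section Kernel

open Function

variable {X : Type*} [MeasurableSpace X]
  {B₁ B₂ : Type*} [NormedAddCommGroup B₁] [NormedSpace ℝ B₁]
  [NormedAddCommGroup B₂] [NormedSpace ℝ B₂]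

theorem integrable_clm_apply_of_bound {ν : Measure X} {k : X → B₁ →L[ℝ] B₂}
    (hk : Integrable k ν) {f : X → B₁} (hf : AEStronglyMeasurable f ν) {M : ℝ}
    (hM : ∀ᵐ y ∂ν, ‖f y‖ ≤ M) : Integrable (fun y => k y (f y)) ν := by
  refine (hk.norm.mul_const M).mono'
    ((ContinuousLinearMap.apply ℝ B₂).flip.aestronglyMeasurable_comp₂ hk.1 hf) ?_
  filter_upwards [hM] with y hy
  exact (k y).le_of_opNorm_le_of_le le_rfl hy

variable [CompleteSpace B₁] [CompleteSpace B₂]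

/-- Against a function from which its mean has been subtracted, a kernel may be replaced by its
oscillation. -/
theorem enorm_integral_apply_sub_average_le {ν : Measure X} [IsFiniteMeasure ν] [NeZero ν]
    {k : X → B₁ →L[ℝ] B₂} (hk : Integrable k ν) {f : X → B₁} (hf : Integrable f ν) {M : ℝ}
    (hM : ∀ᵐ y ∂ν, ‖f y‖ ≤ M) :
    ‖∫ y, k y (f y - ⨍ z, f z ∂ν) ∂ν‖ₑ ≤
      ∫⁻ y, (ν univ)⁻¹ * (∫⁻ z, ‖k y - k z‖ₑ ∂ν) * ‖f y‖ₑ ∂ν := by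
  have hkf := integrable_clm_apply_of_bound hk hf.1 hM
  set m := ⨍ z, f z ∂ν with hm
  set κ := ⨍ z, k z ∂ν with hκ
  have hmean : ∫ y, k y m ∂ν = ∫ y, κ (f y) ∂ν := by
    rw [← ContinuousLinearMap.integral_apply hk, ContinuousLinearMap.integral_comp_comm κ hf,
      ← measure_smul_average ν f, ← measure_smul_average ν k, ← hm, ← hκ]
    simp
  have hrw : ∫ y, k y (f y - m) ∂ν = ∫ y, (k y - κ) (f y) ∂ν := by
    simp only [map_sub, sub_apply]
    rw [integral_sub hkf (hk.apply_continuousLinearMap m), hmean,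
      ← integral_sub hkf (κ.integrable_comp hf)]
  rw [hrw]
  refine (enorm_integral_le_lintegral_enorm _).trans (lintegral_mono fun y => ?_)
  refine ((k y - κ).le_opENorm (f y)).trans ?_
  gcongr
  have : k y - κ = ⨍ z, (k y - k z) ∂ν := by
    have hν : ν.real univ ≠ 0 := by simp [Measure.real, ENNReal.toReal_eq_zero_iff, NeZero.ne]
    rw [average_eq, integral_sub (integrable_const _) hk, hκ, average_eq, integral_const,
      smul_sub, inv_smul_smul₀ hν]
  rw [this]
  exact enorm_average_le _

/-- The Hörmander condition bounds the image of a single atom. -/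
theorem lintegral_enorm_integral_apply_sub_average_le {ν ζ : Measure X} [IsFiniteMeasure ν]
    [NeZero ν] [SFinite ζ] {K : X → X → B₁ →L[ℝ] B₂} (hK : StronglyMeasurable (uncurry K))
    (hKi : ∀ᵐ x ∂ζ, Integrable (K x) ν) {f : X → B₁} (hf : Integrable f ν) {M : ℝ}
    (hM : ∀ᵐ y ∂ν, ‖f y‖ ≤ M) {C : ℝ≥0∞}
    (hC : ∀ᵐ y ∂ν, ∀ᵐ z ∂ν, ∫⁻ x, ‖K x y - K x z‖ₑ ∂ζ ≤ C) :
    ∫⁻ x, ‖∫ y, K x y (f y - ⨍ z, f z ∂ν) ∂ν‖ₑ ∂ζ ≤ C * ∫⁻ y, ‖f y‖ₑ ∂ν := by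
  have hmeas : Measurable fun q : (X × X) × X => ‖K q.1.1 q.1.2 - K q.1.1 q.2‖ₑ := by
    have h1 : StronglyMeasurable fun q : (X × X) × X => K q.1.1 q.1.2 :=
      hK.comp_measurable measurable_fst
    have h2 : StronglyMeasurable fun q : (X × X) × X => K q.1.1 q.2 :=
      hK.comp_measurable (measurable_fst.fst.prodMk measurable_snd)
    exact (h1.sub h2).enorm
  have hν0 : ν univ ≠ 0 := NeZero.ne _
  calc ∫⁻ x, ‖∫ y, K x y (f y - ⨍ z, f z ∂ν) ∂ν‖ₑ ∂ζ
      ≤ ∫⁻ x, ∫⁻ y, (ν univ)⁻¹ * (∫⁻ z, ‖K x y - K x z‖ₑ ∂ν) * ‖f y‖ₑ ∂ν ∂ζ := by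
        refine lintegral_mono_ae ?_
        filter_upwards [hKi] with x hx
        exact enorm_integral_apply_sub_average_le hx hf hM
    _ = ∫⁻ y, ∫⁻ x, (ν univ)⁻¹ * (∫⁻ z, ‖K x y - K x z‖ₑ ∂ν) * ‖f y‖ₑ ∂ζ ∂ν := by
        refine lintegral_lintegral_swap ?_
        exact ((hmeas.lintegral_prod_right'.const_mul _).aemeasurable).mul hf.1.enorm.comp_snd
    _ ≤ ∫⁻ y, C * ‖f y‖ₑ ∂ν := by
        refine lintegral_mono_ae ?_
        filter_upwards [hC] with y hy
        have hy' : Measurable fun q : X × X => ‖K q.1 y - K q.1 q.2‖ₑ :=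
          hmeas.comp (f := fun q : X × X => ((q.1, y), q.2))
            ((measurable_fst.prodMk measurable_const).prodMk measurable_snd)
        have hin : Measurable fun x => ∫⁻ z, ‖K x y - K x z‖ₑ ∂ν := hy'.lintegral_prod_right'
        rw [lintegral_mul_const _ (hin.const_mul _), lintegral_const_mul _ hin,
          lintegral_lintegral_swap (f := fun x z => ‖K x y - K x z‖ₑ) hy'.aemeasurable]
        gcongr
        calc (ν univ)⁻¹ * ∫⁻ z, ∫⁻ x, ‖K x y - K x z‖ₑ ∂ζ ∂ν
            ≤ (ν univ)⁻¹ * ∫⁻ _, C ∂ν := by gcongr 1; exact lintegral_mono_ae hy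
          _ = C := by
            rw [lintegral_const, mul_comm C, ← mul_assoc,
              ENNReal.inv_mul_cancel hν0 (measure_ne_top _ _), one_mul]
    _ = C * ∫⁻ y, ‖f y‖ₑ ∂ν := lintegral_const_mul'' _ hf.1.enorm

/-- The Hörmander condition bounds the image of the bad part `f - goodPart μ Q f`, summing over
the atoms. -/
theorem lintegral_enorm_integral_badPart_le {ι : Type*} [Countable ι] {μ ζ : Measure X}
    [SFinite ζ] {Q : ι → Set X} (hQm : ∀ i, MeasurableSet (Q i))
    (hQ : Pairwise (Function.onFun Disjoint Q)) (hQ0 : ∀ i, μ (Q i) ≠ 0)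
    (hQtop : ∀ i, μ (Q i) ≠ ∞) {F : Set X} (hFm : MeasurableSet F) (hQF : ∀ i, Q i ⊆ F)
    {K : X → X → B₁ →L[ℝ] B₂} (hK : StronglyMeasurable (uncurry K))
    (hKi : ∀ᵐ x ∂ζ, Integrable (K x) (μ.restrict F)) {f : X → B₁} (hf : Integrable f μ) {M : ℝ}
    (hM : ∀ᵐ y ∂μ, ‖f y‖ ≤ M) (hb : ∃ M', ∀ᵐ y ∂μ, ‖f y - goodPart μ Q f y‖ ≤ M') {C : ℝ≥0∞}
    (hC : ∀ i, ∀ᵐ y ∂μ.restrict (Q i), ∀ᵐ z ∂μ.restrict (Q i),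
      ∫⁻ x, ‖K x y - K x z‖ₑ ∂ζ ≤ C) :
    ∫⁻ x, ‖∫ y in F, K x y (f y - goodPart μ Q f y) ∂μ‖ₑ ∂ζ ≤ C * ∫⁻ y, ‖f y‖ₑ ∂μ := by
  obtain ⟨M', hM'⟩ := hb
  have hU : MeasurableSet (⋃ i, Q i) := .iUnion hQm
  have hUF : (⋃ i, Q i) ⊆ F := iUnion_subset hQF
  have hfm : AEStronglyMeasurable (fun y => f y - goodPart μ Q f y) μ :=
    hf.1.sub (aestronglyMeasurable_goodPart hQm hQ hf.1)
  have hpt : ∀ᵐ x ∂ζ, ‖∫ y in F, K x y (f y - goodPart μ Q f y) ∂μ‖ₑ ≤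
      ∑' i, ‖∫ y in Q i, K x y (f y - ⨍ z in Q i, f z ∂μ) ∂μ‖ₑ := by
    filter_upwards [hKi] with x hx
    have hint := integrable_clm_apply_of_bound hx hfm.restrict (ae_restrict_of_ae hM')
    have hsupp : ∫ y in F, K x y (f y - goodPart μ Q f y) ∂μ =
        ∫ y in ⋃ i, Q i, K x y (f y - goodPart μ Q f y) ∂μ := by
      refine setIntegral_eq_of_subset_of_forall_sdiff_eq_zero hFm hUF fun y hy => ?_
      rw [goodPart_of_notMem f hy.2, sub_self, map_zero]
    rw [hsupp, integral_iUnion hQm hQ (IntegrableOn.mono_set hint hUF)]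
    refine (enorm_tsum_le_tsum_enorm).trans (ENNReal.tsum_le_tsum fun i => le_of_eq ?_)
    congr 1
    exact setIntegral_congr_fun (hQm i) fun y hy => by simp only [goodPart_of_mem hQ f hy]
  calc ∫⁻ x, ‖∫ y in F, K x y (f y - goodPart μ Q f y) ∂μ‖ₑ ∂ζ
      ≤ ∫⁻ x, ∑' i, ‖∫ y in Q i, K x y (f y - ⨍ z in Q i, f z ∂μ) ∂μ‖ₑ ∂ζ :=
        lintegral_mono_ae hpt
    _ = ∑' i, ∫⁻ x, ‖∫ y in Q i, K x y (f y - ⨍ z in Q i, f z ∂μ) ∂μ‖ₑ ∂ζ := by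
        refine lintegral_tsum fun i => ?_
        have : IsFiniteMeasure (μ.restrict (Q i)) :=
          isFiniteMeasure_restrict.2 (hQtop i)
        have h1 : AEStronglyMeasurable (fun q : X × X => K q.1 q.2
            (f q.2 - ⨍ z in Q i, f z ∂μ)) (ζ.prod (μ.restrict (Q i))) :=
          (ContinuousLinearMap.apply ℝ B₂).flip.aestronglyMeasurable_comp₂
            hK.aestronglyMeasurable
            ((hf.1.restrict.sub aestronglyMeasurable_const).comp_snd)
        exact h1.integral_prod_right'.enorm
    _ ≤ ∑' i, C * ∫⁻ y in Q i, ‖f y‖ₑ ∂μ := by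
        refine ENNReal.tsum_le_tsum fun i => ?_
        have : IsFiniteMeasure (μ.restrict (Q i)) :=
          isFiniteMeasure_restrict.2 (hQtop i)
        have : NeZero (μ.restrict (Q i)) :=
          ⟨fun h => hQ0 i (Measure.restrict_eq_zero.1 h)⟩
        refine lintegral_enorm_integral_apply_sub_average_le hK ?_ hf.restrict
          (ae_restrict_of_ae hM) (hC i)
        filter_upwards [hKi] with x hx
        exact IntegrableOn.mono_set hx (hQF i)
    _ = C * ∫⁻ y in ⋃ i, Q i, ‖f y‖ₑ ∂μ := by
        rw [ENNReal.tsum_mul_left, lintegral_iUnion hQm hQ]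
    _ ≤ C * ∫⁻ y, ‖f y‖ₑ ∂μ := by gcongr; exact Measure.restrict_le_self

end Kernel

/-! ### Functions as elements of `LpOn` -/

section LpOn

variable {X : Type*} [MeasurableSpace X] {μ : Measure X} {B B₁ B₂ : Type*}
  [NormedAddCommGroup B] [NormedAddCommGroup B₁] [NormedSpace ℝ B₁]
  [NormedAddCommGroup B₂] [NormedSpace ℝ B₂] {r : ℝ≥0∞} {E V : Set X}

/-- The element of `χ_V L^r(μ; B)` represented by a function in `L^r` that vanishes off `V`. -/
noncomputable def LpOn.ofMemLp [NormedSpace ℝ B] (u : X → B) (hu : MemLp u r μ) (hV : ∀ᵐ x ∂μ, x ∉ V → u x = 0) :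
    LpOn B r μ V :=
  ⟨hu.toLp u, by
    change ∀ᵐ x ∂μ, x ∉ V → hu.toLp u x = 0
    filter_upwards [hV, hu.coeFn_toLp] with x hx h hxV
    rw [h, hx hxV]⟩

theorem LpOn.coeFn_ofMemLp [NormedSpace ℝ B] {u : X → B} (hu : MemLp u r μ) (hV : ∀ᵐ x ∂μ, x ∉ V → u x = 0) :
    (LpOn.ofMemLp u hu hV : Lp B r μ) =ᵐ[μ] u :=
  hu.coeFn_toLp

theorem LpOn.coeFn_add [NormedSpace ℝ B] (f g : LpOn B r μ V) :
    ((f + g : LpOn B r μ V) : Lp B r μ) =ᵐ[μ] fun x => (f : Lp B r μ) x + (g : Lp B r μ) x :=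
  Lp.coeFn_add (f : Lp B r μ) g

theorem LpOn.eq_add_of_ae [NormedSpace ℝ B] {f g h : LpOn B r μ V}
    (H : ∀ᵐ x ∂μ, (f : Lp B r μ) x = (g : Lp B r μ) x + (h : Lp B r μ) x) : f = g + h := by
  refine Subtype.ext (Lp.ext ?_)
  filter_upwards [H, LpOn.coeFn_add g h] with x h1 h2
  rw [h1, h2]

/-- Bounded functions that vanish off a set of finite measure are in every `L^r`. -/
theorem memLp_of_bound_of_support {u : X → B} (hu : AEStronglyMeasurable u μ)
    (hVm : MeasurableSet V) (hVfin : μ V ≠ ∞) (hV : ∀ᵐ x ∂μ, x ∉ V → u x = 0) {M : ℝ}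
    (hM : ∀ᵐ x ∂μ, ‖u x‖ ≤ M) (r : ℝ≥0∞) : MemLp u r μ := by
  refine (memLp_indicator_const r hVm M (Or.inr hVfin)).mono' hu ?_
  filter_upwards [hV, hM] with x h1 h2
  by_cases hx : x ∈ V
  · simpa [hx] using h2
  · simp [hx, h1 hx]

theorem eLpNorm_apply_le_of_norm_le [Fact (1 ≤ r)] {T : LpOn B₁ r μ V →L[ℝ] LpOn B₂ r μ E} {A : ℝ}
    (hA : 0 ≤ A) (hT : ∀ f, ‖T f‖ ≤ A * ‖f‖) (f : LpOn B₁ r μ V) :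
    eLpNorm (T f : Lp B₂ r μ) r μ ≤ ENNReal.ofReal A * eLpNorm (f : Lp B₁ r μ) r μ := by
  have h := hT f
  rw [Submodule.coe_norm, Submodule.coe_norm, Lp.norm_def, Lp.norm_def] at h
  rw [← ENNReal.ofReal_toReal (Lp.eLpNorm_ne_top (T f : Lp B₂ r μ)),
    ← ENNReal.ofReal_toReal (Lp.eLpNorm_ne_top (f : Lp B₁ r μ)), ← ENNReal.ofReal_mul hA]
  exact ENNReal.ofReal_le_ofReal h

end LpOn

/-! ### The weak type `(1, 1)` estimate -/

section WeakType

open Function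

theorem eLpNorm_le_mul_eLpNorm_iff {X : Type*} [MeasurableSpace X] {μ : Measure X}
    {B₁ B₂ : Type*} [NormedAddCommGroup B₁] [NormedAddCommGroup B₂] {r : ℝ≥0∞} (hr0 : r ≠ 0) (hr : r ≠ ∞)
    {w : X → B₂} {h : X → B₁}
    {c : ℝ≥0∞} : eLpNorm w r μ ≤ c * eLpNorm h r μ ↔
      ∫⁻ x, ‖w x‖ₑ ^ r.toReal ∂μ ≤ c ^ r.toReal * ∫⁻ x, ‖h x‖ₑ ^ r.toReal ∂μ := by
  have hs0 : 0 < r.toReal := ENNReal.toReal_pos hr0 hr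
  rw [eLpNorm_eq_lintegral_rpow_enorm_toReal hr0 hr, eLpNorm_eq_lintegral_rpow_enorm_toReal hr0 hr,
    one_div, ENNReal.rpow_inv_le_iff hs0, ENNReal.mul_rpow_of_nonneg _ _ hs0.le,
    ENNReal.rpow_inv_rpow hs0.ne']

/-- If `w` is bounded by `A` times `h` in `L^r`, and `A ‖h‖ ≤ t` almost everywhere, then `w`
satisfies the weak type estimate of constant `A` at level `t`. The exponent `r` does not enter
the constant because `‖h‖ ^ r` is at most `(t / A) ^ (r - 1) ‖h‖`. -/
theorem mul_measure_lt_enorm_le_of_bounded {X : Type*} [MeasurableSpace X] {μ : Measure X}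
    {B₁ B₂ : Type*} [NormedAddCommGroup B₁] [NormedAddCommGroup B₂] {r : ℝ≥0∞} (hr : 1 ≤ r)
    {h : X → B₁} (hh : AEStronglyMeasurable h μ) {w : X → B₂} (hw : AEStronglyMeasurable w μ)
    {A G t : ℝ≥0∞} (hwh : eLpNorm w r μ ≤ A * eLpNorm h r μ)
    (hG : ∀ᵐ x ∂μ, ‖h x‖ₑ ≤ G) (ht0 : t ≠ 0) (ht : t ≠ ∞) (hAG : A * G ≤ t) :
    t * μ {x | t < ‖w x‖ₑ} ≤ A * ∫⁻ x, ‖h x‖ₑ ∂μ := by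
  rcases eq_or_ne r ∞ with rfl | hr'
  · have h1 : eLpNorm h ∞ μ ≤ G := by
      rw [eLpNorm_exponent_top]; exact eLpNormEssSup_le_of_ae_enorm_bound hG
    have h2 : ∀ᵐ x ∂μ, ‖w x‖ₑ ≤ t := by
      rw [eLpNorm_exponent_top] at hwh h1
      filter_upwards [enorm_ae_le_eLpNormEssSup w μ] with x hx
      exact (hx.trans hwh).trans ((mul_le_mul_right h1 A).trans hAG)
    have h3 : μ {x | t < ‖w x‖ₑ} = 0 := by
      rw [← compl_mem_ae_iff]
      filter_upwards [h2] with x hx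
      exact not_lt.2 hx
    rw [h3, mul_zero]
    exact zero_le
  have hr0 : r ≠ 0 := (zero_lt_one.trans_le hr).ne'
  have hs : 1 ≤ r.toReal := by
    rw [← ENNReal.toReal_one]; exact ENNReal.toReal_mono hr' hr
  have hs0 : 0 < r.toReal := zero_lt_one.trans_le hs
  rw [eLpNorm_le_mul_eLpNorm_iff hr0 hr'] at hwh
  have hsplit : ∀ c : ℝ≥0∞, c ^ r.toReal = c ^ (r.toReal - 1) * c := by
    intro c
    conv_lhs => rw [show r.toReal = (r.toReal - 1) + 1 by ring]
    rw [ENNReal.rpow_add_of_nonneg _ _ (by linarith) zero_le_one, ENNReal.rpow_one]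
  have hpow0 : t ^ (r.toReal - 1) ≠ 0 := by simp [ENNReal.rpow_eq_zero_iff, ht0, ht]
  have hpow : t ^ (r.toReal - 1) ≠ ∞ := ENNReal.rpow_ne_top_of_nonneg (by linarith) ht
  rw [← ENNReal.mul_le_mul_iff_right hpow0 hpow]
  calc t ^ (r.toReal - 1) * (t * μ {x | t < ‖w x‖ₑ})
      = t ^ r.toReal * μ {x | t < ‖w x‖ₑ} := by rw [hsplit]; ring
    _ ≤ t ^ r.toReal * μ {x | t ^ r.toReal ≤ ‖w x‖ₑ ^ r.toReal} := by
      gcongr with x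
      exact fun hx => ENNReal.rpow_le_rpow (le_of_lt hx) hs0.le
    _ ≤ ∫⁻ x, ‖w x‖ₑ ^ r.toReal ∂μ := mul_meas_ge_le_lintegral₀ (hw.enorm.pow_const _) _
    _ ≤ A ^ r.toReal * ∫⁻ x, ‖h x‖ₑ ^ r.toReal ∂μ := hwh
    _ ≤ A ^ r.toReal * ∫⁻ x, G ^ (r.toReal - 1) * ‖h x‖ₑ ∂μ := by
      gcongr 1
      refine lintegral_mono_ae ?_
      filter_upwards [hG] with x hx
      rw [hsplit]
      gcongr
    _ = (A * G) ^ (r.toReal - 1) * (A * ∫⁻ x, ‖h x‖ₑ ∂μ) := by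
      rw [lintegral_const_mul'' _ hh.enorm, hsplit,
        ENNReal.mul_rpow_of_nonneg _ _ (by linarith : 0 ≤ r.toReal - 1)]
      ring
    _ ≤ t ^ (r.toReal - 1) * (A * ∫⁻ x, ‖h x‖ₑ ∂μ) := by
      gcongr

variable {X : Type*} [MetricSpace X] [MeasurableSpace X] [BorelSpace X]
  [SecondCountableTopology X] {μ : Measure X} [IsLocallyFiniteMeasure μ]
  {B₁ B₂ : Type*} [NormedAddCommGroup B₁] [NormedSpace ℝ B₁] [CompleteSpace B₁]
  [NormedAddCommGroup B₂] [NormedSpace ℝ B₂] [CompleteSpace B₂]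
  {R : ℝ} {D : ℝ≥0∞} {r : ℝ≥0∞} [Fact (1 ≤ r)] {E : Set X}

/-- Away from the enlarged balls of a Calderón–Zygmund covering, the image of the bad part is
bounded in `L^1` by the Hörmander constant. -/
theorem CZCovering.lintegral_badPart_le {T : LpOn B₁ r μ (thickening (R / 2) E) →L[ℝ] LpOn B₂ r μ E}
    {K : X → X → B₁ →L[ℝ] B₂}
    (hK : AEStronglyMeasurable (uncurry K)
      ((μ.restrict E).prod (μ.restrict (thickening (R / 2) E))))
    (hker : HasKernelOffDiagonal μ R r E T K) {C : ℝ} (hH : HormanderCondition μ R E K C)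
    (hVfin : μ (thickening (R / 2) E) ≠ ∞) {a : X → ℝ≥0∞} {γ : ℝ≥0∞}
    (cz : CZCovering μ D R E a γ) {f : X → B₁} (hf : Integrable f μ) {M : ℝ}
    (hM : ∀ᵐ y ∂μ, ‖f y‖ ≤ M) {M' : ℝ} (hM' : ∀ᵐ y ∂μ, ‖f y - goodPart μ cz.Q f y‖ ≤ M')
    {b : LpOn B₁ r μ (thickening (R / 2) E)}
    (hb : (b : Lp B₁ r μ) =ᵐ[μ] fun y => f y - goodPart μ cz.Q f y) :
    ∫⁻ x in E \ ⋃ i, closedBall (cz.c i) (32 * cz.ρ i), ‖(T b : Lp B₂ r μ) x‖ₑ ∂μ ≤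
      ENNReal.ofReal C * ∫⁻ y, ‖f y‖ₑ ∂μ := by
  have := cz.countable
  set Ω := ⋃ i, closedBall (cz.c i) (32 * cz.ρ i)
  set F := ⋃ i, ball (cz.c i) (8 * cz.ρ i)
  have hFo : IsOpen F := isOpen_iUnion fun _ => isOpen_ball
  have hFV : F ⊆ (thickening (R / 2) E) := iUnion_subset fun i y hy => mem_thickening_iff.2
    ⟨cz.c i, cz.c_mem i, by linarith [mem_ball.1 hy, cz.ρ_lt i, cz.ρ_pos i]⟩
  have hQF : ∀ i, cz.Q i ⊆ F := fun i => (cz.Q_subset i).trans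
    ((closedBall_subset_ball (by linarith [cz.ρ_pos i])).trans
      (subset_iUnion (fun i => ball (cz.c i) (8 * cz.ρ i)) i))
  have hFΩ : F ⊆ Ω := iUnion_mono fun i =>
    ball_subset_closedBall.trans (closedBall_subset_closedBall (by linarith [cz.ρ_pos i]))
  have hEΩ : E \ Ω ⊆ E \ F := sdiff_subset_sdiff_right hFΩ
  -- The kernel may be replaced by a strongly measurable one.
  obtain ⟨K', hK', hKK'⟩ : ∃ K' : X → X → B₁ →L[ℝ] B₂, StronglyMeasurable (uncurry K') ∧
      ∀ᵐ (q : X × X) ∂(μ.restrict E).prod (μ.restrict (thickening (R / 2) E)), K q.1 q.2 = K' q.1 q.2 :=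
    ⟨fun x y => hK.mk _ (x, y), hK.stronglyMeasurable_mk, hK.ae_eq_mk.mono fun _ h => h⟩
  have hx : ∀ᵐ x ∂μ.restrict E, ∀ᵐ y ∂μ.restrict (thickening (R / 2) E), K x y = K' x y :=
    Measure.ae_ae_of_ae_prod hKK'
  have hy : ∀ᵐ y ∂μ.restrict (thickening (R / 2) E), ∀ᵐ x ∂μ.restrict E, K x y = K' x y :=
    Measure.ae_ae_of_ae_prod
      (p := fun q : X × X => K q.2 q.1 = K' q.2 q.1)
      (Measure.measurePreserving_swap.quasiMeasurePreserving.ae hKK')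
  obtain ⟨hint, hrep⟩ := hker F hFo hFV
  have hb0 : (b : Lp B₁ r μ) ∈ LpOn B₁ r μ F := by
    change ∀ᵐ x ∂μ, x ∉ F → (b : Lp B₁ r μ) x = 0
    filter_upwards [hb] with x hx hxF
    rw [hx, goodPart_of_notMem f fun h => hxF (iUnion_subset hQF h), sub_self]
  have hbtop : MemLp (b : Lp B₁ r μ) ∞ μ := by
    refine memLp_top_of_bound (Lp.aestronglyMeasurable _) M' ?_
    filter_upwards [hb, hM'] with x hx hx'
    rwa [hx]
  have hxΩ := ae_restrict_of_ae_restrict_of_subset (sdiff_subset : E \ Ω ⊆ E) hx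
  have hKi : ∀ᵐ x ∂μ.restrict (E \ Ω), Integrable (K' x) (μ.restrict F) := by
    filter_upwards [ae_restrict_of_ae_restrict_of_subset hEΩ hint.prod_right_ae, hxΩ]
      with x h1 h2
    exact h1.congr (ae_restrict_of_ae_restrict_of_subset hFV h2)
  have hTb : ∀ᵐ x ∂μ.restrict (E \ Ω), (T b : Lp B₂ r μ) x =
      ∫ y in F, K' x y (f y - goodPart μ cz.Q f y) ∂μ := by
    filter_upwards [ae_restrict_of_ae_restrict_of_subset hEΩ (hrep b hbtop hb0), hxΩ]
      with x h1 h2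
    rw [h1]
    refine integral_congr_ae ?_
    filter_upwards [ae_restrict_of_ae_restrict_of_subset hFV h2, ae_restrict_of_ae hb]
      with y h3 h4
    rw [h3, h4]
  rw [lintegral_congr_ae (hTb.mono fun x hx => congrArg _ hx)]
  refine lintegral_enorm_integral_badPart_le cz.measurableSet_Q cz.disjoint_Q
    cz.measure_Q_ne_zero
    (fun i => ne_top_of_le_ne_top hVfin (measure_mono ((hQF i).trans hFV)))
    hFo.measurableSet hQF hK' hKi hf hM ⟨M', hM'⟩ fun i => ?_
  have hQV : cz.Q i ⊆ (thickening (R / 2) E) := (hQF i).trans hFV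
  have hyQ := ae_restrict_of_ae_restrict_of_subset hQV hy
  filter_upwards [ae_restrict_of_ae_restrict_of_subset hQV hH, hyQ,
    ae_restrict_mem (cz.measurableSet_Q i)] with y h1 h2 hyi
  filter_upwards [ae_restrict_of_ae_restrict_of_subset hQV h1, hyQ,
    ae_restrict_mem (cz.measurableSet_Q i)] with z h3 h4 hzi
  have hyc := mem_closedBall.1 (cz.Q_subset i hyi)
  have hzc := mem_closedBall.1 (cz.Q_subset i hzi)
  have hyz : dist y z ≤ 8 * cz.ρ i := by
    linarith [dist_triangle_right y z (cz.c i)]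
  -- Points outside `closedBall (c i) (32 ρ)` are at distance at least `28 ρ ≥ 2 d(y, z)` from `y`.
  have hsub : E \ Ω ⊆ E \ ball y (2 * dist y z) := by
    refine fun x hx => ⟨hx.1, fun hxy => hx.2 (mem_iUnion.2 ⟨i, ?_⟩)⟩
    rw [mem_closedBall]
    linarith [mem_ball.1 hxy, dist_triangle x y (cz.c i), cz.ρ_pos i]
  calc ∫⁻ x in E \ Ω, ‖K' x y - K' x z‖ₑ ∂μ = ∫⁻ x in E \ Ω, ‖K x y - K x z‖ₑ ∂μ := by
        refine lintegral_congr_ae ?_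
        filter_upwards [ae_restrict_of_ae_restrict_of_subset (sdiff_subset : E \ Ω ⊆ E) h2,
          ae_restrict_of_ae_restrict_of_subset (sdiff_subset : E \ Ω ⊆ E) h4] with x h5 h6
        rw [h5, h6]
    _ ≤ ∫⁻ x in E \ ball y (2 * dist y z), ‖K x y - K x z‖ₑ ∂μ := lintegral_mono_set hsub
    _ ≤ ENNReal.ofReal C := h3 (by linarith [cz.ρ_lt i, cz.ρ_pos i])

variable [μ.IsOpenPosMeasure] [IsUnifLocDoublingMeasure μ]

set_option maxHeartbeats 1000000 in
/-- The weak type `(1, 1)` estimate for bounded functions on `E`. The height `γ` of the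
Calderón–Zygmund decomposition is chosen so that `D ^ 5 / γ`, which controls the exceptional set,
is `2 M / t`; the good part is then at most `D ^ 2 γ = D ^ 7 t / (2 M)`, small enough
for the `L^r` bound. -/
theorem mul_measure_lt_enorm_apply_le (hR : 0 < R) (hD1 : 1 ≤ D) (hD : D ≠ ∞)
    (hdb : ∀ (x : X) (ρ : ℝ) (n : ℕ), 0 < ρ → 2 ^ n * ρ ≤ 4 * R →
      μ (closedBall x (2 ^ n * ρ)) ≤ D ^ n * μ (closedBall x ρ))
    (hdiam : ∀ x ∈ E, ∀ y ∈ E, dist x y ≤ R)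
    (hVfin : μ (thickening (R / 2) E) ≠ ∞)
    {T : LpOn B₁ r μ (thickening (R / 2) E) →L[ℝ] LpOn B₂ r μ E}
    {K : X → X → B₁ →L[ℝ] B₂}
    (hK : AEStronglyMeasurable (uncurry K)
      ((μ.restrict E).prod (μ.restrict (thickening (R / 2) E))))
    (hker : HasKernelOffDiagonal μ R r E T K) {A : ℝ} (hA : 0 < A)
    (hT : ∀ f, ‖T f‖ ≤ A * ‖f‖) {C : ℝ} (hH : HormanderCondition μ R E K C)
    {f : LpOn B₁ r μ (thickening (R / 2) E)} (hf : (f : Lp B₁ r μ) ∈ LpOn B₁ r μ E)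
    {M : ℝ} (hM : ∀ᵐ x ∂μ, ‖(f : Lp B₁ r μ) x‖ ≤ M) (t : ℝ≥0∞) :
    t * μ {x | t < ‖(T f : Lp B₂ r μ) x‖ₑ} ≤
      4 * (D ^ 9 * ENNReal.ofReal A + ENNReal.ofReal C) * ∫⁻ x, ‖(f : Lp B₁ r μ) x‖ₑ ∂μ := by
  rcases eq_or_ne t 0 with rfl | ht0
  · simp
  rcases eq_or_ne t ∞ with rfl | ht
  · simp
  have hVm : MeasurableSet (thickening (R / 2) E) := isOpen_thickening.measurableSet
  have hEV : E ⊆ (thickening (R / 2) E) := self_subset_thickening (by positivity) E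
  have hfV : ∀ᵐ x ∂μ, x ∉ (thickening (R / 2) E) → (f : Lp B₁ r μ) x = 0 := f.2
  have hfm : AEStronglyMeasurable (f : Lp B₁ r μ) μ := Lp.aestronglyMeasurable _
  have hfint : Integrable (f : Lp B₁ r μ) μ :=
    memLp_one_iff_integrable.1 (memLp_of_bound_of_support hfm hVm hVfin hfV hM 1)
  set A' := ENNReal.ofReal A
  set C' := ENNReal.ofReal C
  set N := D ^ 9 * A' + C' with hN
  set I := ∫⁻ x, ‖(f : Lp B₁ r μ) x‖ₑ ∂μ
  have hA0 : A' ≠ 0 := (ENNReal.ofReal_pos.2 hA).ne'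
  have hD0 : D ≠ 0 := (zero_lt_one.trans_le hD1).ne'
  have hAN : D ^ 9 * A' ≤ N := le_self_add
  have hN0 : N ≠ 0 := fun h => by
    rw [h, nonpos_iff_eq_zero, mul_eq_zero] at hAN
    exact hAN.elim (pow_ne_zero 9 hD0) hA0
  have hNtop : N ≠ ∞ := by simp [hN, A', C', ENNReal.mul_eq_top, hD]
  have h2N0 : 2 * N ≠ 0 := mul_ne_zero two_ne_zero hN0
  have h2Ntop : 2 * N ≠ ∞ := ENNReal.mul_ne_top ENNReal.ofNat_ne_top hNtop
  have hD50 : D ^ 5 ≠ 0 := pow_ne_zero 5 hD0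
  have hD5 : D ^ 5 ≠ ∞ := ENNReal.pow_ne_top hD
  obtain ⟨γ, hγ⟩ : ∃ γ, γ * (2 * N) = D ^ 5 * t :=
    ⟨D ^ 5 * t / (2 * N), ENNReal.div_mul_cancel h2N0 h2Ntop⟩
  have hγtop : γ ≠ ∞ := fun h => by
    rw [h, ENNReal.top_mul h2N0] at hγ
    exact ENNReal.mul_ne_top hD5 ht hγ.symm
  have hlevel : ∀ m, γ * m ≤ D ^ 5 * I → t * m ≤ 2 * N * I := by
    intro m hm
    rw [← ENNReal.mul_le_mul_iff_right hD50 hD5]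
    calc D ^ 5 * (t * m) = 2 * N * (γ * m) := by rw [← mul_assoc, ← hγ]; ring
      _ ≤ 2 * N * (D ^ 5 * I) := by gcongr
      _ = D ^ 5 * (2 * N * I) := by ring
  rcases measure_le_or_nonempty_czCovering μ hR hdb hdiam hfm.enorm hfint.2.ne (γ := γ)
    with hsmall | ⟨⟨cz⟩⟩
  · have hsub : μ {x | t < ‖(T f : Lp B₂ r μ) x‖ₑ} ≤ μ E := by
      refine measure_mono_ae ?_
      have hTE : ∀ᵐ x ∂μ, x ∉ E → (T f : Lp B₂ r μ) x = 0 := (T f).2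
      filter_upwards [hTE] with x hx hlt
      by_contra hxE
      have hlt' : t < ‖(T f : Lp B₂ r μ) x‖ₑ := hlt
      simp [hx hxE] at hlt'
    calc t * μ {x | t < ‖(T f : Lp B₂ r μ) x‖ₑ} ≤ t * μ E := by gcongr
      _ ≤ 2 * N * I := hlevel _ hsmall
      _ ≤ 4 * N * I := by gcongr; norm_num
  have := cz.countable
  have hQE : ∀ i, cz.Q i ⊆ (thickening (R / 2) E) := fun i y hy => mem_thickening_iff.2
    ⟨cz.c i, cz.c_mem i, by
      linarith [mem_closedBall.1 (cz.Q_subset i hy), cz.ρ_lt i, cz.ρ_pos i]⟩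
  set u : X → B₁ := goodPart μ cz.Q (f : Lp B₁ r μ)
  have hum : AEStronglyMeasurable u μ :=
    aestronglyMeasurable_goodPart cz.measurableSet_Q cz.disjoint_Q hfm
  have hu : ∀ᵐ x ∂μ, ‖u x‖ₑ ≤ γ * D ^ 2 := by
    have hfE : ∀ᵐ x ∂μ, x ∉ E → (f : Lp B₁ r μ) x = 0 := hf
    filter_upwards [cz.ae_le, hfE] with x hx hxE
    by_cases hxQ : x ∈ ⋃ i, cz.Q i
    · obtain ⟨i, hi⟩ := mem_iUnion.1 hxQ
      have hQtop : μ (cz.Q i) ≠ ∞ := ne_top_of_le_ne_top hVfin (measure_mono (hQE i))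
      rw [show u x = _ from goodPart_of_mem cz.disjoint_Q _ hi,
        ← ENNReal.mul_le_mul_iff_right (cz.measure_Q_ne_zero i) hQtop]
      exact (measure_mul_enorm_setAverage_le _).trans ((cz.lintegral_Q_le i).trans_eq
        (mul_comm _ _))
    · rw [show u x = _ from goodPart_of_notMem _ hxQ]
      by_cases hxE' : x ∈ E
      · exact (hx hxE' hxQ).trans (le_mul_of_one_le_right zero_le (one_le_pow₀ hD1))
      · simp [hxE hxE']
  have hGtop : γ * D ^ 2 ≠ ∞ := ENNReal.mul_ne_top hγtop (ENNReal.pow_ne_top hD)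
  have hu' : ∀ᵐ x ∂μ, ‖u x‖ ≤ (γ * D ^ 2).toReal := by
    filter_upwards [hu] with x hx
    rw [← toReal_enorm]
    exact ENNReal.toReal_mono hGtop hx
  have huV : ∀ᵐ x ∂μ, x ∉ (thickening (R / 2) E) → u x = 0 := by
    filter_upwards [hfV] with x hx hxV
    rw [← hx hxV]
    exact goodPart_of_notMem _ fun h => hxV (iUnion_subset hQE h)
  have hbd : ∀ᵐ x ∂μ, ‖(f : Lp B₁ r μ) x - u x‖ ≤ M + (γ * D ^ 2).toReal := by
    filter_upwards [hM, hu'] with x h1 h2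
    exact (norm_sub_le _ _).trans (add_le_add h1 h2)
  have hbV : ∀ᵐ x ∂μ, x ∉ (thickening (R / 2) E) → (f : Lp B₁ r μ) x - u x = 0 := by
    filter_upwards [hfV, huV] with x h1 h2 hxV
    rw [h1 hxV, h2 hxV, sub_self]
  let g : LpOn B₁ r μ (thickening (R / 2) E) :=
    LpOn.ofMemLp u (memLp_of_bound_of_support hum hVm hVfin huV hu' r) huV
  let b : LpOn B₁ r μ (thickening (R / 2) E) :=
    LpOn.ofMemLp _ (memLp_of_bound_of_support (hfm.sub hum) hVm hVfin hbV hbd r) hbV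
  have hg : (g : Lp B₁ r μ) =ᵐ[μ] u := LpOn.coeFn_ofMemLp _ _
  have hb : (b : Lp B₁ r μ) =ᵐ[μ] fun x => (f : Lp B₁ r μ) x - u x := LpOn.coeFn_ofMemLp _ _
  have hfgb : f = g + b := LpOn.eq_add_of_ae <| by
    filter_upwards [hg, hb] with x h1 h2
    rw [h1, h2]; abel
  set Ω := ⋃ i, closedBall (cz.c i) (32 * cz.ρ i)
  set S₁ := {x | t / 2 < ‖(T g : Lp B₂ r μ) x‖ₑ}
  set S₂ := {x | t / 2 ≤ ‖(T b : Lp B₂ r μ) x‖ₑ} ∩ (E \ Ω)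
  have hcover : μ {x | t < ‖(T f : Lp B₂ r μ) x‖ₑ} ≤ μ S₁ + μ Ω + μ S₂ := by
    refine le_trans (measure_mono_ae ?_) ((measure_union_le (S₁ ∪ Ω) S₂).trans
      (add_le_add_left (measure_union_le S₁ Ω) _))
    have hTE : ∀ᵐ x ∂μ, x ∉ E → (T f : Lp B₂ r μ) x = 0 := (T f).2
    have hadd : ∀ᵐ x ∂μ, (T f : Lp B₂ r μ) x = (T g : Lp B₂ r μ) x + (T b : Lp B₂ r μ) x := by
      rw [hfgb, map_add]
      exact LpOn.coeFn_add _ _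
    filter_upwards [hTE, hadd] with x hx1 hx2 hlt
    change t < ‖(T f : Lp B₂ r μ) x‖ₑ at hlt
    by_contra hcon
    have h1 : x ∉ S₁ := fun h => hcon (Or.inl (Or.inl h))
    have h2 : x ∉ Ω := fun h => hcon (Or.inl (Or.inr h))
    have h3 : x ∉ S₂ := fun h => hcon (Or.inr h)
    have hxE : x ∈ E := by
      by_contra hxE
      simp [hx1 hxE] at hlt
    have h4 : ‖(T b : Lp B₂ r μ) x‖ₑ ≤ t / 2 := le_of_lt (not_le.1 fun h => h3 ⟨h, hxE, h2⟩)
    refine absurd hlt (not_lt.2 ?_)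
    rw [hx2]
    exact (enorm_add_le _ _).trans ((add_le_add (not_lt.1 h1) h4).trans_eq (ENNReal.add_halves t))
  have ht20 : t / 2 ≠ 0 := (ENNReal.half_pos ht0).ne'
  have ht2 : t / 2 ≠ ∞ := ENNReal.div_ne_top ht two_ne_zero
  have hdouble : ∀ m : ℝ≥0∞, t * m = 2 * (t / 2 * m) := fun m => by
    rw [← mul_assoc, ENNReal.mul_div_cancel two_ne_zero ENNReal.ofNat_ne_top]
  have hgood : t * μ S₁ ≤ 2 * (A' * I) := by
    rw [hdouble]
    gcongr 2 * ?_
    refine (mul_measure_lt_enorm_le_of_bounded Fact.out (Lp.aestronglyMeasurable (g : Lp B₁ r μ))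
      (Lp.aestronglyMeasurable _)
      (eLpNorm_apply_le_of_norm_le hA.le hT g) (G := γ * D ^ 2) ?_ ht20 ht2 ?_).trans ?_
    · filter_upwards [hg, hu] with x h1 h2
      rwa [h1]
    · rw [ENNReal.le_div_iff_mul_le (Or.inl two_ne_zero) (Or.inl ENNReal.ofNat_ne_top),
        ← ENNReal.mul_le_mul_iff_right hN0 hNtop]
      calc N * (A' * (γ * D ^ 2) * 2) = A' * D ^ 2 * (γ * (2 * N)) := by ring
        _ = D ^ 7 * A' * t := by rw [hγ]; ring
        _ ≤ D ^ 9 * A' * t := by gcongr; norm_num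
        _ ≤ N * t := by gcongr
    · gcongr 1
      rw [lintegral_congr_ae (hg.mono fun x hx => congrArg _ hx)]
      exact lintegral_enorm_goodPart_le cz.measurableSet_Q cz.disjoint_Q _
  have hbad : t * μ S₂ ≤ 2 * (C' * I) := by
    rw [hdouble]
    gcongr 2 * ?_
    calc t / 2 * μ S₂
        ≤ t / 2 * μ.restrict (E \ Ω) {x | t / 2 ≤ ‖(T b : Lp B₂ r μ) x‖ₑ} := by
          gcongr 1; exact Measure.le_restrict_apply _ _
      _ ≤ ∫⁻ x in E \ Ω, ‖(T b : Lp B₂ r μ) x‖ₑ ∂μ :=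
          mul_meas_ge_le_lintegral₀ (Lp.aestronglyMeasurable _).enorm.restrict _
      _ ≤ C' * I := cz.lintegral_badPart_le hK hker hH hVfin hfint hM hbd hb
  calc t * μ {x | t < ‖(T f : Lp B₂ r μ) x‖ₑ} ≤ t * (μ S₁ + μ Ω + μ S₂) := by gcongr
    _ = t * μ S₁ + t * μ Ω + t * μ S₂ := by ring
    _ ≤ 2 * (A' * I) + 2 * N * I + 2 * (C' * I) := by
      gcongr ?_ + ?_ + ?_
      exact hlevel _ cz.measure_enlarged_le
    _ = 2 * (A' + C') * I + 2 * N * I := by ring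
    _ ≤ 2 * N * I + 2 * N * I := by
      gcongr 2 * ?_ * _ + _
      rw [hN]
      gcongr
      exact le_mul_of_one_le_left zero_le (one_le_pow₀ hD1)
    _ = 4 * N * I := by ring

end WeakType

/-! ### Integration over truncation levels -/

section Levels

theorem lintegral_Ioo_rpow {c e : ℝ} (hc : 0 ≤ c) (he : 0 < e) :
    ∫⁻ σ in Ioo 0 c, ENNReal.ofReal (σ ^ (e - 1)) = ENNReal.ofReal (c ^ e / e) := by
  have hint : IntegrableOn (fun σ : ℝ => σ ^ (e - 1)) (Ioc 0 c) :=
    (intervalIntegrable_iff_integrableOn_Ioc_of_le hc).1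
      (intervalIntegral.intervalIntegrable_rpow' (by linarith))
  rw [setLIntegral_congr Ioo_ae_eq_Ioc, ← ofReal_integral_eq_lintegral_ofReal hint
    (by
      filter_upwards [ae_restrict_mem measurableSet_Ioc] with σ hσ
      exact Real.rpow_nonneg hσ.1.le _),
    ← intervalIntegral.integral_of_le hc, integral_rpow (Or.inl (by linarith))]
  simp [Real.zero_rpow he.ne']

theorem lintegral_Ici_rpow {c e : ℝ} (hc : 0 < c) (he : 0 < e) :
    ∫⁻ σ in Ici c, ENNReal.ofReal (σ ^ (-e - 1)) = ENNReal.ofReal (c ^ (-e) / e) := by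
  rw [setLIntegral_congr Ioi_ae_eq_Ici.symm, ← ofReal_integral_eq_lintegral_ofReal
    (integrableOn_Ioi_rpow_of_lt (by linarith) hc)
    (by
      filter_upwards [ae_restrict_mem measurableSet_Ioi] with σ hσ
      exact Real.rpow_nonneg (hc.trans hσ).le _), integral_Ioi_rpow_of_lt (by linarith) hc]
  congr 1
  rw [sub_add_cancel, div_neg, neg_div, neg_neg]

variable {X : Type*} [MeasurableSpace X] {μ : Measure X} [SFinite μ] {B : Type*}
  [NormedAddCommGroup B] {f : X → B}

/-- The parts of `f` above the levels `s σ`, integrated against a power of `σ`. -/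
theorem lintegral_rpow_mul_setLIntegral_lt (hf : StronglyMeasurable f) {q p s : ℝ} (hq : 0 ≤ q)
    (hqp : q < p) (hs : 0 < s) :
    ∫⁻ σ in Ioi (0 : ℝ), ENNReal.ofReal (σ ^ (p - q - 1)) *
        ∫⁻ x in {x | s * σ < ‖f x‖}, ‖f x‖ₑ ^ q ∂μ =
      ENNReal.ofReal (s ^ (q - p) / (p - q)) * ∫⁻ x, ‖f x‖ₑ ^ p ∂μ := by
  have hS : MeasurableSet {z : ℝ × X | s * z.1 < ‖f z.2‖} :=
    measurableSet_lt (measurable_fst.const_mul s) (hf.norm.measurable.comp measurable_snd)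
  let H : ℝ × X → ℝ≥0∞ := {z : ℝ × X | s * z.1 < ‖f z.2‖}.indicator
    fun z => ENNReal.ofReal (z.1 ^ (p - q - 1)) * ‖f z.2‖ₑ ^ q
  have hH : Measurable H := by
    refine Measurable.indicator (Measurable.mul ?_ ?_) hS
    · exact (measurable_fst.pow_const _).ennreal_ofReal
    · exact ((hf.enorm.comp measurable_snd).pow_const _)
  calc ∫⁻ σ in Ioi (0 : ℝ), ENNReal.ofReal (σ ^ (p - q - 1)) *
        ∫⁻ x in {x | s * σ < ‖f x‖}, ‖f x‖ₑ ^ q ∂μ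
      = ∫⁻ σ in Ioi (0 : ℝ), ∫⁻ x, H (σ, x) ∂μ := by
        refine lintegral_congr fun σ => ?_
        rw [← lintegral_const_mul _ (hf.enorm.pow_const _), ← lintegral_indicator
          (measurableSet_lt measurable_const hf.norm.measurable)]
        rfl
    _ = ∫⁻ x, (∫⁻ σ in Ioi (0 : ℝ), H (σ, x)) ∂μ :=
        lintegral_lintegral_swap (f := fun σ x => H (σ, x)) hH.aemeasurable
    _ = ∫⁻ x, ENNReal.ofReal (s ^ (q - p) / (p - q)) * ‖f x‖ₑ ^ p ∂μ := by
        refine lintegral_congr fun x => ?_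
        have h1 : ∀ σ, H (σ, x) = (Iio (‖f x‖ / s)).indicator
            (fun σ => ENNReal.ofReal (σ ^ (p - q - 1)) * ‖f x‖ₑ ^ q) σ := by
          intro σ
          simp only [H, indicator, mem_ofPred_eq, mem_Iio, lt_div_iff₀ hs, mul_comm s]
        rw [lintegral_congr h1, lintegral_indicator measurableSet_Iio,
          Measure.restrict_restrict measurableSet_Iio, Iio_inter_Ioi,
          lintegral_mul_const _ (by fun_prop),
          lintegral_Ioo_rpow (by positivity) (by linarith), ← ofReal_norm,
          ENNReal.ofReal_rpow_of_nonneg (norm_nonneg _) hq,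
          ENNReal.ofReal_rpow_of_nonneg (norm_nonneg _) (by linarith),
          ← ENNReal.ofReal_mul (div_nonneg (by positivity) (by linarith)),
          ← ENNReal.ofReal_mul (div_nonneg (by positivity) (by linarith))]
        congr 1
        have h2 : ‖f x‖ ^ p = ‖f x‖ ^ (p - q) * ‖f x‖ ^ q := by
          rw [← Real.rpow_add_of_nonneg (norm_nonneg _) (by linarith) hq]; ring_nf
        rw [h2, Real.div_rpow (norm_nonneg _) hs.le, show q - p = -(p - q) by ring,
          Real.rpow_neg hs.le]
        ring
    _ = _ := lintegral_const_mul _ (hf.enorm.pow_const _)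

/-- The parts of `f` below the levels `s σ`, integrated against a power of `σ`. -/
theorem lintegral_rpow_mul_setLIntegral_le (hf : StronglyMeasurable f) {r p s : ℝ} (hp : 0 < p)
    (hpr : p < r) (hs : 0 < s) :
    ∫⁻ σ in Ioi (0 : ℝ), ENNReal.ofReal (σ ^ (p - r - 1)) *
        ∫⁻ x in {x | ‖f x‖ ≤ s * σ}, ‖f x‖ₑ ^ r ∂μ =
      ENNReal.ofReal (s ^ (r - p) / (r - p)) * ∫⁻ x, ‖f x‖ₑ ^ p ∂μ := by
  have hr : 0 < r := hp.trans hpr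
  have hS : MeasurableSet {z : ℝ × X | ‖f z.2‖ ≤ s * z.1} :=
    measurableSet_le (hf.norm.measurable.comp measurable_snd) (measurable_fst.const_mul s)
  let H : ℝ × X → ℝ≥0∞ := {z : ℝ × X | ‖f z.2‖ ≤ s * z.1}.indicator
    fun z => ENNReal.ofReal (z.1 ^ (p - r - 1)) * ‖f z.2‖ₑ ^ r
  have hH : Measurable H := by
    refine Measurable.indicator (Measurable.mul ?_ ?_) hS
    · exact (measurable_fst.pow_const _).ennreal_ofReal
    · exact ((hf.enorm.comp measurable_snd).pow_const _)
  calc ∫⁻ σ in Ioi (0 : ℝ), ENNReal.ofReal (σ ^ (p - r - 1)) *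
        ∫⁻ x in {x | ‖f x‖ ≤ s * σ}, ‖f x‖ₑ ^ r ∂μ
      = ∫⁻ σ in Ioi (0 : ℝ), ∫⁻ x, H (σ, x) ∂μ := by
        refine lintegral_congr fun σ => ?_
        rw [← lintegral_const_mul _ (hf.enorm.pow_const _), ← lintegral_indicator
          (measurableSet_le hf.norm.measurable measurable_const)]
        rfl
    _ = ∫⁻ x, (∫⁻ σ in Ioi (0 : ℝ), H (σ, x)) ∂μ :=
        lintegral_lintegral_swap (f := fun σ x => H (σ, x)) hH.aemeasurable
    _ = ∫⁻ x, ENNReal.ofReal (s ^ (r - p) / (r - p)) * ‖f x‖ₑ ^ p ∂μ := by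
        refine lintegral_congr fun x => ?_
        have h1 : ∀ σ, H (σ, x) = (Ici (‖f x‖ / s)).indicator
            (fun σ => ENNReal.ofReal (σ ^ (p - r - 1)) * ‖f x‖ₑ ^ r) σ := by
          intro σ
          simp only [H, indicator, mem_ofPred_eq, mem_Ici, div_le_iff₀ hs, mul_comm s]
        rw [lintegral_congr h1]
        rcases eq_or_ne (f x) 0 with h0 | h0
        · simp [h0, hr, hp]
        have hn : 0 < ‖f x‖ := norm_pos_iff.2 h0
        rw [lintegral_indicator measurableSet_Ici,
          Measure.restrict_restrict measurableSet_Ici,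
          inter_eq_left.2 (Ici_subset_Ioi.2 (show (0 : ℝ) < ‖f x‖ / s by positivity)),
          lintegral_mul_const _ (by fun_prop), show p - r - 1 = -(r - p) - 1 by ring,
          lintegral_Ici_rpow (by positivity) (by linarith), ← ofReal_norm,
          ENNReal.ofReal_rpow_of_nonneg (norm_nonneg _) hr.le,
          ENNReal.ofReal_rpow_of_nonneg (norm_nonneg _) hp.le,
          ← ENNReal.ofReal_mul (div_nonneg (by positivity) (by linarith)),
          ← ENNReal.ofReal_mul (div_nonneg (by positivity) (by linarith))]
        congr 1
        have h2 : ‖f x‖ ^ p = ‖f x‖ ^ (-(r - p)) * ‖f x‖ ^ r := by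
          rw [← Real.rpow_add hn]; ring_nf
        rw [h2, Real.div_rpow (norm_nonneg _) hs.le, Real.rpow_neg hs.le]
        field_simp
    _ = _ := lintegral_const_mul _ (hf.enorm.pow_const _)

end Levels

/-! ### Truncations and comparison of levels -/

section Interpolation

variable {X : Type*} [MeasurableSpace X] {μ : Measure X} {B B₁ B₂ : Type*}
  [NormedAddCommGroup B] [NormedAddCommGroup B₁] [NormedAddCommGroup B₂]

/-- Integration over `σ` of the truncated norms of `f` at the levels `s σ`. -/
theorem lintegral_levels [SFinite μ] {f : X → B} (hf : StronglyMeasurable f) {q p r s : ℝ}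
    (hq : 0 ≤ q) (hqp : q < p) (hpr : p < r) (hs : 0 < s) (α β : ℝ≥0∞) :
    ∫⁻ σ in Ioi (0 : ℝ), ENNReal.ofReal (σ ^ (p - 1)) *
        (α * (ENNReal.ofReal (σ ^ (-q)) * ∫⁻ x in {x | s * σ < ‖f x‖}, ‖f x‖ₑ ^ q ∂μ) +
          β * (ENNReal.ofReal (σ ^ (-r)) * ∫⁻ x in {x | ‖f x‖ ≤ s * σ}, ‖f x‖ₑ ^ r ∂μ)) =
      (α * ENNReal.ofReal (s ^ (q - p) / (p - q)) + β * ENNReal.ofReal (s ^ (r - p) / (r - p))) *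
        ∫⁻ x, ‖f x‖ₑ ^ p ∂μ := by
  have hP : Measurable fun σ : ℝ => ∫⁻ x in {x | s * σ < ‖f x‖}, ‖f x‖ₑ ^ q ∂μ := by
    refine Antitone.measurable fun σ τ hστ => lintegral_mono_set fun x hx => ?_
    exact lt_of_le_of_lt (mul_le_mul_of_nonneg_left hστ hs.le) hx
  have hQ : Measurable fun σ : ℝ => ∫⁻ x in {x | ‖f x‖ ≤ s * σ}, ‖f x‖ₑ ^ r ∂μ := by
    refine Monotone.measurable fun σ τ hστ => lintegral_mono_set fun x hx => ?_
    exact le_trans hx (mul_le_mul_of_nonneg_left hστ hs.le)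
  have hmul : ∀ σ : ℝ, 0 < σ → ∀ e : ℝ, ENNReal.ofReal (σ ^ (p - e - 1)) =
      ENNReal.ofReal (σ ^ (p - 1)) * ENNReal.ofReal (σ ^ (-e)) := by
    intro σ hσ e
    rw [← ENNReal.ofReal_mul (Real.rpow_nonneg hσ.le _), ← Real.rpow_add hσ]
    ring_nf
  calc _ = ∫⁻ σ in Ioi (0 : ℝ),
        (α * (ENNReal.ofReal (σ ^ (p - q - 1)) *
            ∫⁻ x in {x | s * σ < ‖f x‖}, ‖f x‖ₑ ^ q ∂μ) +
          β * (ENNReal.ofReal (σ ^ (p - r - 1)) *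
            ∫⁻ x in {x | ‖f x‖ ≤ s * σ}, ‖f x‖ₑ ^ r ∂μ)) := by
        refine setLIntegral_congr_fun measurableSet_Ioi fun σ hσ => ?_
        simp only [hmul σ hσ]
        ring
    _ = _ := by
        rw [lintegral_add_left (by fun_prop), lintegral_const_mul _ (by fun_prop),
          lintegral_const_mul _ (by fun_prop), lintegral_rpow_mul_setLIntegral_lt hf hq hqp hs,
          lintegral_rpow_mul_setLIntegral_le hf (hq.trans_lt hqp) hpr hs]
        ring

/-- A comparison of truncated norms of `w` and `f` at every level `σ` integrates to a comparison of
their `L^p` norms. The factors `1 / (p - q)` and `1 / (r - p)` produced by the integration appear on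
both sides and cancel in `k`, so that the resulting constant `N` need not degenerate when `p`
approaches an endpoint. -/
theorem lintegral_rpow_le_of_levels [SFinite μ] {w : X → B₂} (hw : StronglyMeasurable w)
    {f : X → B₁} (hf : StronglyMeasurable f) {q q' p r r' s : ℝ}
    (hq : 0 ≤ q) (hqp : q < p) (hpr : p < r) (hq' : 0 ≤ q') (hqp' : q' < p) (hpr' : p < r')
    (hs : 0 < s) {α β α' β' : ℝ≥0∞}
    (H : ∀ σ : ℝ, 0 < σ →
      α * (ENNReal.ofReal (σ ^ (-q)) * ∫⁻ x in {x | σ < ‖w x‖}, ‖w x‖ₑ ^ q ∂μ) +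
        β * (ENNReal.ofReal (σ ^ (-r)) * ∫⁻ x in {x | ‖w x‖ ≤ σ}, ‖w x‖ₑ ^ r ∂μ) ≤
      α' * (ENNReal.ofReal (σ ^ (-q')) * ∫⁻ x in {x | s * σ < ‖f x‖}, ‖f x‖ₑ ^ q' ∂μ) +
        β' * (ENNReal.ofReal (σ ^ (-r')) * ∫⁻ x in {x | ‖f x‖ ≤ s * σ}, ‖f x‖ₑ ^ r' ∂μ))
    {k N : ℝ} (hk : 0 < k)
    (hkα : ENNReal.ofReal k ≤
      α * ENNReal.ofReal (1 / (p - q)) + β * ENNReal.ofReal (1 / (r - p)))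
    (hkN : α' * ENNReal.ofReal (s ^ (q' - p) / (p - q')) +
      β' * ENNReal.ofReal (s ^ (r' - p) / (r' - p)) ≤ ENNReal.ofReal (k * N)) :
    ∫⁻ x, ‖w x‖ₑ ^ p ∂μ ≤ ENNReal.ofReal N * ∫⁻ x, ‖f x‖ₑ ^ p ∂μ := by
  rw [← ENNReal.mul_le_mul_iff_right (ENNReal.ofReal_pos.2 hk).ne' ENNReal.ofReal_ne_top,
    ← mul_assoc, ← ENNReal.ofReal_mul hk.le]
  refine (mul_le_mul_left hkα _).trans (le_trans ?_ (mul_le_mul_left hkN _))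
  have h1 := lintegral_levels (μ := μ) hw hq hqp hpr one_pos α β
  have h2 := lintegral_levels (μ := μ) hf hq' hqp' hpr' hs α' β'
  simp only [one_mul, Real.one_rpow] at h1
  rw [← h1, ← h2]
  refine setLIntegral_mono' measurableSet_Ioi fun σ hσ => ?_
  gcongr 1
  exact H σ hσ

theorem eLpNorm_le_of_lintegral_rpow_le {w : X → B₂} {f : X → B₁} {p c n e : ℝ}
    (hp : 0 < p)
    (hc : 0 < c) (hn : 0 < n)
    (h : ∫⁻ x, ‖w x‖ₑ ^ p ∂μ ≤ ENNReal.ofReal (c ^ p * n ^ (e * p)) * ∫⁻ x, ‖f x‖ₑ ^ p ∂μ) :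
    eLpNorm w (ENNReal.ofReal p) μ ≤
      ENNReal.ofReal c * ENNReal.ofReal (n ^ e) * eLpNorm f (ENNReal.ofReal p) μ := by
  rw [eLpNorm_le_mul_eLpNorm_iff (ENNReal.ofReal_pos.2 hp).ne' ENNReal.ofReal_ne_top,
    ENNReal.toReal_ofReal hp.le, ← ENNReal.ofReal_mul hc.le,
    ENNReal.ofReal_rpow_of_nonneg (by positivity) hp.le, Real.mul_rpow hc.le (by positivity),
    ← Real.rpow_mul hn.le]
  exact h

theorem lintegral_enorm_rpow_eq_of_ae_eq_indicator {f g : X → B} {S : Set X}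
    (hS : MeasurableSet S) (h : g =ᵐ[μ] S.indicator f) {q : ℝ} (hq : 0 < q) :
    ∫⁻ x, ‖g x‖ₑ ^ q ∂μ = ∫⁻ x in S, ‖f x‖ₑ ^ q ∂μ := by
  rw [← lintegral_indicator hS]
  refine lintegral_congr_ae ?_
  filter_upwards [h] with x hx
  rw [hx]
  by_cases hxS : x ∈ S <;> simp [hxS, hq]

variable [NormedSpace ℝ B] [NormedSpace ℝ B₁] [NormedSpace ℝ B₂] {r : ℝ≥0∞} {E V : Set X}

/-- Bounded functions that are concentrated on `E`. -/
def LpOn.IsBoundedOn (E : Set X) (f : LpOn B r μ V) : Prop :=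
  (f : Lp B r μ) ∈ LpOn B r μ E ∧ ∃ M : ℝ, ∀ᵐ x ∂μ, ‖(f : Lp B r μ) x‖ ≤ M

theorem LpOn.mem_of_ae_eq_indicator {f g : LpOn B r μ V} (hf : (f : Lp B r μ) ∈ LpOn B r μ E)
    {S : Set X} (h : (g : Lp B r μ) =ᵐ[μ] S.indicator (f : Lp B r μ)) :
    (g : Lp B r μ) ∈ LpOn B r μ E := by
  have hf' : ∀ᵐ x ∂μ, x ∉ E → (f : Lp B r μ) x = 0 := hf
  change ∀ᵐ x ∂μ, x ∉ E → (g : Lp B r μ) x = 0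
  filter_upwards [h, hf'] with x h1 h2 hx
  by_cases hxS : x ∈ S <;> simp [h1, hxS, h2 hx]

theorem LpOn.IsBoundedOn.of_indicator {f g : LpOn B r μ V} (hf : LpOn.IsBoundedOn E f) {S : Set X}
    (h : (g : Lp B r μ) =ᵐ[μ] S.indicator (f : Lp B r μ)) : LpOn.IsBoundedOn E g := by
  obtain ⟨hfE, M, hM⟩ := hf
  refine ⟨LpOn.mem_of_ae_eq_indicator hfE h, M, ?_⟩
  filter_upwards [h, hM] with x h1 h2
  rw [h1]
  exact (norm_indicator_le_norm_self _ _).trans h2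

theorem LpOn.IsBoundedOn.eLpNorm_ne_top {f : LpOn B r μ V} (hf : LpOn.IsBoundedOn E f)
    (hVm : MeasurableSet V) (hVfin : μ V ≠ ∞) (p : ℝ≥0∞) : eLpNorm (f : Lp B r μ) p μ ≠ ∞ := by
  obtain ⟨M, hM⟩ := hf.2
  exact (memLp_of_bound_of_support (Lp.aestronglyMeasurable _) hVm hVfin f.2 hM p).2.ne

/-- The splitting of `f` into its parts above and below the level `c`. -/
theorem LpOn.exists_truncation (f : LpOn B r μ V) (c : ℝ) : ∃ g h : LpOn B r μ V, f = g + h ∧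
    (g : Lp B r μ) =ᵐ[μ] {x | c < ‖(f : Lp B r μ) x‖}.indicator (f : Lp B r μ) ∧
    (h : Lp B r μ) =ᵐ[μ] {x | ‖(f : Lp B r μ) x‖ ≤ c}.indicator (f : Lp B r μ) := by
  have hm := (Lp.stronglyMeasurable (f : Lp B r μ)).norm.measurable
  have hfV : ∀ᵐ x ∂μ, x ∉ V → (f : Lp B r μ) x = 0 := f.2
  have hex : ∀ S : Set X, MeasurableSet S →
      ∃ g : LpOn B r μ V, (g : Lp B r μ) =ᵐ[μ] S.indicator (f : Lp B r μ) := by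
    intro S hS
    refine ⟨LpOn.ofMemLp _ ((Lp.memLp (f : Lp B r μ)).indicator hS) ?_, LpOn.coeFn_ofMemLp _ _⟩
    filter_upwards [hfV] with x h2 hx
    by_cases hxS : x ∈ S <;> simp [hxS, h2 hx]
  obtain ⟨g, hg⟩ := hex _ (measurableSet_lt (measurable_const (a := c)) hm)
  obtain ⟨h, hh⟩ := hex _ (measurableSet_le hm (measurable_const (a := c)))
  refine ⟨g, h, LpOn.eq_add_of_ae ?_, hg, hh⟩
  filter_upwards [hg, hh] with x h1 h2
  rw [h1, h2]
  rcases le_or_gt ‖(f : Lp B r μ) x‖ c with h | h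
  · simp [h, not_lt.2 h]
  · simp [h, not_le.2 h]

end Interpolation

/-! ### Real interpolation -/

section Interpolation

variable {X : Type*} [MeasurableSpace X] {μ : Measure X}

theorem le_ofReal_div_mul_of_mul_le {c a : ℝ} (hc : 0 < c) {m I : ℝ≥0∞}
    (h : ENNReal.ofReal c * m ≤ ENNReal.ofReal a * I) : m ≤ ENNReal.ofReal (a / c) * I := by
  rw [ENNReal.ofReal_div_of_pos hc, div_eq_mul_inv, mul_right_comm, ← div_eq_mul_inv,
    ENNReal.le_div_iff_mul_le (Or.inl (ENNReal.ofReal_pos.2 hc).ne')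
      (Or.inl ENNReal.ofReal_ne_top), mul_comm]
  exact h

theorem rpow_mul_inv_rpow_sub {w : ℝ} (hw : 0 < w) (a b : ℝ) : w ^ a * w⁻¹ ^ (a - b) = w ^ b := by
  rw [Real.inv_rpow hw.le, ← Real.rpow_neg hw.le, ← Real.rpow_add hw]
  ring_nf

theorem ofReal_rpow_neg_mul_enorm_rpow {B : Type*} [NormedAddCommGroup B] {σ : ℝ} (hσ : 0 < σ)
    {e : ℝ} (he : 0 ≤ e) (c : ℝ) (hc : 0 ≤ c) (v : B) :
    ENNReal.ofReal (c ^ e) * (ENNReal.ofReal (σ ^ (-e)) * ‖v‖ₑ ^ e) =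
      ENNReal.ofReal ((c * ‖v‖ / σ) ^ e) := by
  rw [← ofReal_norm, ENNReal.ofReal_rpow_of_nonneg (norm_nonneg _) he,
    ← ENNReal.ofReal_mul (by positivity), ← ENNReal.ofReal_mul (by positivity),
    Real.div_rpow (by positivity) hσ.le, Real.mul_rpow hc (norm_nonneg _), Real.rpow_neg hσ.le]
  congr 1
  ring

/-- For `q ≤ r` the function `u ↦ min (u ^ q) (u ^ r)` is quasi-subadditive with constant `2`, and
the two summands may be measured by its two branches separately. -/
theorem min_rpow_le_add {q r u u₁ u₂ : ℝ} (hq : 0 ≤ q) (hqr : q ≤ r) (hu : 0 ≤ u) (hu₁ : 0 ≤ u₁)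
    (hu₂ : 0 ≤ u₂) (h : u ≤ u₁ + u₂) :
    min (u ^ q) (u ^ r) ≤ (2 * u₁) ^ q + (2 * u₂) ^ r := by
  have h1 : 0 ≤ (2 * u₁) ^ q := by positivity
  have h2 : 0 ≤ (2 * u₂) ^ r := by positivity
  rcases le_total u₁ u₂ with h12 | h12
  · have : u ^ r ≤ (2 * u₂) ^ r := Real.rpow_le_rpow hu (by linarith) (hq.trans hqr)
    linarith [min_le_right (u ^ q) (u ^ r)]
  · have : u ^ q ≤ (2 * u₁) ^ q := Real.rpow_le_rpow hu (by linarith) hq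
    linarith [min_le_left (u ^ q) (u ^ r)]

variable {B₁ B₂ : Type*} [NormedAddCommGroup B₁] [NormedSpace ℝ B₁]
  [NormedAddCommGroup B₂] [NormedSpace ℝ B₂] {r : ℝ≥0∞} [Fact (1 ≤ r)] {E V : Set X}
  {T : LpOn B₁ r μ V →L[ℝ] LpOn B₂ r μ E} {A W : ℝ}

theorem LpOn.apply_add_ae (g h : LpOn B₁ r μ V) :
    ∀ᵐ x ∂μ, (T (g + h) : Lp B₂ r μ) x = (T g : Lp B₂ r μ) x + (T h : Lp B₂ r μ) x := by
  rw [map_add]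
  exact LpOn.coeFn_add _ _

theorem measure_lt_norm_apply_add_le (g h : LpOn B₁ r μ V) {σ : ℝ} (hσ : 0 ≤ σ) :
    μ {x | σ < ‖(T (g + h) : Lp B₂ r μ) x‖} ≤
      μ {x | ENNReal.ofReal (σ / 2) < ‖(T g : Lp B₂ r μ) x‖ₑ} +
        μ {x | ENNReal.ofReal (σ / 2) < ‖(T h : Lp B₂ r μ) x‖ₑ} := by
  refine le_trans (measure_mono_ae ?_) (measure_union_le _ _)
  filter_upwards [LpOn.apply_add_ae (T := T) g h] with x hx hlt
  change σ < ‖(T (g + h) : Lp B₂ r μ) x‖ at hlt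
  by_contra hcon
  have h1 : ¬ ENNReal.ofReal (σ / 2) < ‖(T g : Lp B₂ r μ) x‖ₑ := fun h => hcon (Or.inl h)
  have h2 : ¬ ENNReal.ofReal (σ / 2) < ‖(T h : Lp B₂ r μ) x‖ₑ := fun h => hcon (Or.inr h)
  rw [not_lt, ← ofReal_norm] at h1 h2
  rw [ENNReal.ofReal_le_ofReal_iff (by positivity)] at h1 h2
  rw [hx] at hlt
  linarith [norm_add_le ((T g : Lp B₂ r μ) x) ((T h : Lp B₂ r μ) x)]

/-- The weak type estimate bounds the contribution of the large part of a truncation. -/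
theorem measure_lt_enorm_apply_large_le
    (hweak : ∀ g : LpOn B₁ r μ V, LpOn.IsBoundedOn E g → ∀ t : ℝ≥0∞,
      t * μ {x | t < ‖(T g : Lp B₂ r μ) x‖ₑ} ≤
        ENNReal.ofReal W * ∫⁻ x, ‖(g : Lp B₁ r μ) x‖ₑ ∂μ)
    {f g : LpOn B₁ r μ V} (hf : LpOn.IsBoundedOn E f) {S : Set X} (hS : MeasurableSet S)
    (hg : (g : Lp B₁ r μ) =ᵐ[μ] S.indicator (f : Lp B₁ r μ)) {σ : ℝ} (hσ : 0 < σ) :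
    μ {x | ENNReal.ofReal (σ / 2) < ‖(T g : Lp B₂ r μ) x‖ₑ} ≤ ENNReal.ofReal (2 * W) *
      (ENNReal.ofReal (σ ^ (-1 : ℝ)) * ∫⁻ x in S, ‖(f : Lp B₁ r μ) x‖ₑ ^ (1 : ℝ) ∂μ) := by
  have h1 := le_ofReal_div_mul_of_mul_le (half_pos hσ)
    (hweak g (LpOn.IsBoundedOn.of_indicator hf hg) (ENNReal.ofReal (σ / 2)))
  have h2 := lintegral_enorm_rpow_eq_of_ae_eq_indicator hS hg one_pos
  simp only [ENNReal.rpow_one] at h2 ⊢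
  rw [h2] at h1
  refine h1.trans_eq ?_
  rw [← mul_assoc, ← ENNReal.ofReal_mul' (by positivity), Real.rpow_neg_one]
  congr 2
  field_simp

/-- Marcinkiewicz interpolation between weak type `(1, 1)` and strong type `(r, r)`, `r < ∞`. -/
theorem lintegral_enorm_apply_rpow_le_of_weak [SFinite μ] (hr : r ≠ ∞) (hA : 0 < A) (hAW : A ≤ W)
    (hstrong : ∀ g : LpOn B₁ r μ V, eLpNorm (T g : Lp B₂ r μ) r μ ≤
      ENNReal.ofReal A * eLpNorm (g : Lp B₁ r μ) r μ)
    (hweak : ∀ g : LpOn B₁ r μ V, LpOn.IsBoundedOn E g → ∀ t : ℝ≥0∞,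
      t * μ {x | t < ‖(T g : Lp B₂ r μ) x‖ₑ} ≤
        ENNReal.ofReal W * ∫⁻ x, ‖(g : Lp B₁ r μ) x‖ₑ ∂μ)
    {q : ℝ} (hq : 1 < q) (hqr : q < r.toReal) {f : LpOn B₁ r μ V} (hf : LpOn.IsBoundedOn E f) :
    ∫⁻ x, ‖(T f : Lp B₂ r μ) x‖ₑ ^ q ∂μ ≤
      ENNReal.ofReal ((2 * W) ^ q * (q / (q - 1) + q / (r.toReal - q))) *
        ∫⁻ x, ‖(f : Lp B₁ r μ) x‖ₑ ^ q ∂μ := by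
  have hr0 : r ≠ 0 := (zero_lt_one.trans_le Fact.out).ne'
  have hq0 : 0 < q := zero_lt_one.trans hq
  have hρ : 0 < r.toReal := hq0.trans hqr
  have hW : 0 < W := hA.trans_le hAW
  have hfm := (Lp.stronglyMeasurable (f : Lp B₁ r μ)).norm.measurable
  refine lintegral_rpow_le_of_levels (Lp.stronglyMeasurable _) (Lp.stronglyMeasurable _)
    (q := 0) (r := q + 1) (α := 1) (β := 0) (q' := 1) (r' := r.toReal)
    (α' := ENNReal.ofReal (2 * W)) (β' := ENNReal.ofReal ((2 * A) ^ r.toReal))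
    (s := (2 * W)⁻¹) (k := 1 / q) le_rfl hq0 (lt_add_one q) zero_le_one hq hqr (by positivity)
    (fun σ hσ => ?_) (by positivity) (by simp) ?_
  · simp only [one_mul, zero_mul, add_zero, neg_zero, Real.rpow_zero, ENNReal.ofReal_one,
      ENNReal.rpow_zero, setLIntegral_one]
    obtain ⟨g, h, rfl, hg, hh⟩ := LpOn.exists_truncation f ((2 * W)⁻¹ * σ)
    refine (measure_lt_norm_apply_add_le g h hσ.le).trans (add_le_add ?_ ?_)
    · exact measure_lt_enorm_apply_large_le hweak hf (measurableSet_lt measurable_const hfm) hg hσ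
    · have h1 : ENNReal.ofReal ((σ / 2) ^ r.toReal) *
          μ {x | ENNReal.ofReal (σ / 2) < ‖(T h : Lp B₂ r μ) x‖ₑ} ≤
          ENNReal.ofReal (A ^ r.toReal) * ∫⁻ x, ‖(h : Lp B₁ r μ) x‖ₑ ^ r.toReal ∂μ := by
        have h2 := (eLpNorm_le_mul_eLpNorm_iff hr0 hr).1 (hstrong h)
        rw [ENNReal.ofReal_rpow_of_nonneg hA.le hρ.le] at h2
        refine le_trans ?_ h2
        refine le_trans ?_ (mul_meas_ge_le_lintegral₀
          ((Lp.aestronglyMeasurable _).enorm.pow_const _) (ENNReal.ofReal ((σ / 2) ^ r.toReal)))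
        gcongr with x
        intro hx
        rw [← ENNReal.ofReal_rpow_of_nonneg (by positivity) hρ.le]
        exact ENNReal.rpow_le_rpow (le_of_lt hx) hρ.le
      rw [lintegral_enorm_rpow_eq_of_ae_eq_indicator (measurableSet_le hfm measurable_const) hh hρ]
        at h1
      refine (le_ofReal_div_mul_of_mul_le (by positivity) h1).trans_eq ?_
      rw [← mul_assoc, ← ENNReal.ofReal_mul (by positivity), Real.rpow_neg hσ.le,
        Real.div_rpow hσ.le zero_le_two, Real.mul_rpow zero_le_two hA.le]
      congr 2
      field_simp
  · have h2W : 0 < 2 * W := by positivity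
    have hq1 : 0 < q - 1 := by linarith
    have hrq : 0 < r.toReal - q := by linarith
    rw [← ENNReal.ofReal_mul (by positivity), ← ENNReal.ofReal_mul (by positivity),
      ← ENNReal.ofReal_add (by positivity) (by positivity)]
    refine ENNReal.ofReal_le_ofReal ?_
    have h1 : 2 * W * (2 * W)⁻¹ ^ (1 - q) = (2 * W) ^ q := by
      simpa using rpow_mul_inv_rpow_sub h2W 1 q
    have h2 : (2 * A) ^ r.toReal * (2 * W)⁻¹ ^ (r.toReal - q) ≤ (2 * W) ^ q := by
      rw [← rpow_mul_inv_rpow_sub h2W r.toReal q]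
      gcongr
    calc 2 * W * ((2 * W)⁻¹ ^ (1 - q) / (q - 1)) +
          (2 * A) ^ r.toReal * ((2 * W)⁻¹ ^ (r.toReal - q) / (r.toReal - q))
        = 2 * W * (2 * W)⁻¹ ^ (1 - q) / (q - 1) +
          (2 * A) ^ r.toReal * (2 * W)⁻¹ ^ (r.toReal - q) / (r.toReal - q) := by ring
      _ ≤ (2 * W) ^ q / (q - 1) + (2 * W) ^ q / (r.toReal - q) := by
          rw [h1]; gcongr
      _ = 1 / q * ((2 * W) ^ q * (q / (q - 1) + q / (r.toReal - q))) := by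
          field_simp

theorem ae_norm_apply_le_of_top {T : LpOn B₁ ∞ μ V →L[ℝ] LpOn B₂ ∞ μ E} (hA : 0 ≤ A)
    (hstrong : ∀ g : LpOn B₁ ∞ μ V, eLpNorm (T g : Lp B₂ ∞ μ) ∞ μ ≤
      ENNReal.ofReal A * eLpNorm (g : Lp B₁ ∞ μ) ∞ μ)
    {h : LpOn B₁ ∞ μ V} {c : ℝ} (hc : 0 ≤ c) (hh : ∀ᵐ x ∂μ, ‖(h : Lp B₁ ∞ μ) x‖ ≤ c) :
    ∀ᵐ x ∂μ, ‖(T h : Lp B₂ ∞ μ) x‖ ≤ A * c := by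
  have h1 := hstrong h
  rw [eLpNorm_exponent_top, eLpNorm_exponent_top] at h1
  have h2 : eLpNormEssSup (h : Lp B₁ ∞ μ) μ ≤ ENNReal.ofReal c := eLpNormEssSup_le_of_ae_bound hh
  filter_upwards [enorm_ae_le_eLpNormEssSup (T h : Lp B₂ ∞ μ) μ] with x hx
  have h3 := hx.trans (h1.trans (mul_le_mul_right h2 _))
  rwa [← ENNReal.ofReal_mul hA, ← ofReal_norm, ENNReal.ofReal_le_ofReal_iff (by positivity)] at h3

/-- Marcinkiewicz interpolation between weak type `(1, 1)` and `L^∞`. -/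
theorem lintegral_enorm_apply_rpow_le_of_weak_of_top [SFinite μ]
    {T : LpOn B₁ ∞ μ V →L[ℝ] LpOn B₂ ∞ μ E} (hA : 0 < A) (hAW : A ≤ W)
    (hstrong : ∀ g : LpOn B₁ ∞ μ V, eLpNorm (T g : Lp B₂ ∞ μ) ∞ μ ≤
      ENNReal.ofReal A * eLpNorm (g : Lp B₁ ∞ μ) ∞ μ)
    (hweak : ∀ g : LpOn B₁ ∞ μ V, LpOn.IsBoundedOn E g → ∀ t : ℝ≥0∞,
      t * μ {x | t < ‖(T g : Lp B₂ ∞ μ) x‖ₑ} ≤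
        ENNReal.ofReal W * ∫⁻ x, ‖(g : Lp B₁ ∞ μ) x‖ₑ ∂μ)
    {q : ℝ} (hq : 1 < q) {f : LpOn B₁ ∞ μ V} (hf : LpOn.IsBoundedOn E f) :
    ∫⁻ x, ‖(T f : Lp B₂ ∞ μ) x‖ₑ ^ q ∂μ ≤
      ENNReal.ofReal ((2 * W) ^ q * (q / (q - 1))) *
        ∫⁻ x, ‖(f : Lp B₁ ∞ μ) x‖ₑ ^ q ∂μ := by
  have hq0 : 0 < q := zero_lt_one.trans hq
  have hW : 0 < W := hA.trans_le hAW
  have hfm := (Lp.stronglyMeasurable (f : Lp B₁ ∞ μ)).norm.measurable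
  refine lintegral_rpow_le_of_levels (Lp.stronglyMeasurable _) (Lp.stronglyMeasurable _)
    (q := 0) (r := q + 1) (α := 1) (β := 0) (q' := 1) (r' := q + 1)
    (α' := ENNReal.ofReal (2 * W)) (β' := 0)
    (s := (2 * W)⁻¹) (k := 1 / q) le_rfl hq0 (lt_add_one q) zero_le_one hq (lt_add_one q)
    (by positivity) (fun σ hσ => ?_) (by positivity) (by simp) ?_
  · simp only [one_mul, zero_mul, add_zero, neg_zero, Real.rpow_zero, ENNReal.ofReal_one,
      ENNReal.rpow_zero, setLIntegral_one]
    obtain ⟨g, h, rfl, hg, hh⟩ := LpOn.exists_truncation f ((2 * W)⁻¹ * σ)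
    have hh' : ∀ᵐ x ∂μ, ‖(T h : Lp B₂ ∞ μ) x‖ ≤ A * ((2 * W)⁻¹ * σ) := by
      refine ae_norm_apply_le_of_top hA.le hstrong (by positivity) ?_
      filter_upwards [hh] with x hx
      rw [hx, norm_indicator_eq_indicator_norm]
      exact indicator_le' (fun y hy => hy) (fun _ _ => by positivity) x
    have h0 : μ {x | ENNReal.ofReal (σ / 2) < ‖(T h : Lp B₂ ∞ μ) x‖ₑ} = 0 := by
      rw [← compl_mem_ae_iff]
      filter_upwards [hh'] with x hx
      simp only [mem_compl_iff, mem_ofPred_eq, not_lt, ← ofReal_norm]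
      refine ENNReal.ofReal_le_ofReal (hx.trans ?_)
      calc A * ((2 * W)⁻¹ * σ) ≤ W * ((2 * W)⁻¹ * σ) := by gcongr
        _ = σ / 2 := by field_simp
    refine (measure_lt_norm_apply_add_le g h hσ.le).trans ?_
    rw [h0, add_zero]
    exact measure_lt_enorm_apply_large_le hweak hf (measurableSet_lt measurable_const hfm) hg hσ
  · have h2W : 0 < 2 * W := by positivity
    have hq1 : 0 < q - 1 := by linarith
    rw [zero_mul, add_zero, ← ENNReal.ofReal_mul (by positivity)]
    refine ENNReal.ofReal_le_ofReal (le_of_eq ?_)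
    have h1 : 2 * W * (2 * W)⁻¹ ^ (1 - q) = (2 * W) ^ q := by
      simpa using rpow_mul_inv_rpow_sub h2W 1 q
    rw [← mul_div_assoc, h1]
    field_simp

/-- Interpolation between strong type `(q, q)` and strong type `(r, r)`, `r < ∞`, at the price of a
factor `2` that does not depend on the exponents. -/
theorem lintegral_enorm_apply_rpow_le_of_strong [SFinite μ] (hr : r ≠ ∞) (hA : 0 < A)
    (hAW : A ≤ W)
    (hstrong : ∀ g : LpOn B₁ r μ V, eLpNorm (T g : Lp B₂ r μ) r μ ≤
      ENNReal.ofReal A * eLpNorm (g : Lp B₁ r μ) r μ)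
    {q p n : ℝ} (hq : 0 < q) (hqp : q < p) (hpr : p < r.toReal) (hn : 0 < n)
    (hstrong_q : ∀ g : LpOn B₁ r μ V, LpOn.IsBoundedOn E g →
      ∫⁻ x, ‖(T g : Lp B₂ r μ) x‖ₑ ^ q ∂μ ≤
        ENNReal.ofReal ((2 * W) ^ q * n) * ∫⁻ x, ‖(g : Lp B₁ r μ) x‖ₑ ^ q ∂μ)
    {f : LpOn B₁ r μ V} (hf : LpOn.IsBoundedOn E f) :
    ∫⁻ x, ‖(T f : Lp B₂ r μ) x‖ₑ ^ p ∂μ ≤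
      ENNReal.ofReal ((4 * W) ^ p * n ^ ((r.toReal - p) / (r.toReal - q))) *
        ∫⁻ x, ‖(f : Lp B₁ r μ) x‖ₑ ^ p ∂μ := by
  have hr0 : r ≠ 0 := (zero_lt_one.trans_le Fact.out).ne'
  have hρ : 0 < r.toReal := (hq.trans hqp).trans hpr
  have hW : 0 < W := hA.trans_le hAW
  have h1p : 0 < p - q := by linarith
  have h2p : 0 < r.toReal - p := by linarith
  have h3p : 0 < r.toReal - q := by linarith
  have hfm := (Lp.stronglyMeasurable (f : Lp B₁ r μ)).norm.measurable
  have hTfm := (Lp.stronglyMeasurable (T f : Lp B₂ r μ)).norm.measurable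
  -- At the truncation ratio `s` below, the bounds from the two endpoints balance.
  refine lintegral_rpow_le_of_levels (Lp.stronglyMeasurable _) (Lp.stronglyMeasurable _)
    (q := q) (r := r.toReal) (α := 1) (β := 1) (q' := q) (r' := r.toReal)
    (α' := ENNReal.ofReal (2 ^ q * ((2 * W) ^ q * n)))
    (β' := ENNReal.ofReal (2 ^ r.toReal * A ^ r.toReal))
    (s := (4 * W)⁻¹ * n ^ (1 / (r.toReal - q))) (k := 1 / (p - q) + 1 / (r.toReal - p))
    hq.le hqp hpr hq.le hqp hpr (by positivity) (fun σ hσ => ?_) (by positivity) ?_ ?_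
  · obtain ⟨g, h, hfgh, hg, hh⟩ := LpOn.exists_truncation f ((4 * W)⁻¹ * n ^ (1 / (r.toReal - q)) * σ)
    have hgq := hstrong_q g (LpOn.IsBoundedOn.of_indicator hf hg)
    have hhr := (eLpNorm_le_mul_eLpNorm_iff hr0 hr).1 (hstrong h)
    rw [ENNReal.ofReal_rpow_of_nonneg hA.le hρ.le] at hhr
    rw [lintegral_enorm_rpow_eq_of_ae_eq_indicator (measurableSet_lt measurable_const hfm) hg hq]
      at hgq
    rw [lintegral_enorm_rpow_eq_of_ae_eq_indicator (measurableSet_le hfm measurable_const) hh hρ]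
      at hhr
    have hpt : ∀ᵐ x ∂μ,
        {x | σ < ‖(T f : Lp B₂ r μ) x‖}.indicator
          (fun x => ENNReal.ofReal (σ ^ (-q)) * ‖(T f : Lp B₂ r μ) x‖ₑ ^ q) x +
        {x | ‖(T f : Lp B₂ r μ) x‖ ≤ σ}.indicator
          (fun x => ENNReal.ofReal (σ ^ (-r.toReal)) * ‖(T f : Lp B₂ r μ) x‖ₑ ^ r.toReal) x ≤
        ENNReal.ofReal (2 ^ q) * (ENNReal.ofReal (σ ^ (-q)) * ‖(T g : Lp B₂ r μ) x‖ₑ ^ q) +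
        ENNReal.ofReal (2 ^ r.toReal) *
          (ENNReal.ofReal (σ ^ (-r.toReal)) * ‖(T h : Lp B₂ r μ) x‖ₑ ^ r.toReal) := by
      filter_upwards [LpOn.apply_add_ae (T := T) g h] with x hx
      rw [← hfgh] at hx
      rw [ofReal_rpow_neg_mul_enorm_rpow hσ hq.le 2 zero_le_two,
        ofReal_rpow_neg_mul_enorm_rpow hσ hρ.le 2 zero_le_two,
        ← ENNReal.ofReal_add (by positivity) (by positivity)]
      have hmin := min_rpow_le_add (q := q) (r := r.toReal)
        (u := ‖(T f : Lp B₂ r μ) x‖ / σ) (u₁ := ‖(T g : Lp B₂ r μ) x‖ / σ)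
        (u₂ := ‖(T h : Lp B₂ r μ) x‖ / σ) hq.le (hqp.trans hpr).le (by positivity) (by positivity)
        (by positivity) (by rw [← add_div, hx]; gcongr; exact norm_add_le _ _)
      rw [← mul_div_assoc, ← mul_div_assoc] at hmin
      have hcq := ofReal_rpow_neg_mul_enorm_rpow hσ hq.le 1 zero_le_one ((T f : Lp B₂ r μ) x)
      have hcr := ofReal_rpow_neg_mul_enorm_rpow hσ hρ.le 1 zero_le_one ((T f : Lp B₂ r μ) x)
      simp only [Real.one_rpow, ENNReal.ofReal_one, one_mul] at hcq hcr
      rcases lt_or_ge σ ‖(T f : Lp B₂ r μ) x‖ with hlt | hle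
      · have h1 : 1 ≤ ‖(T f : Lp B₂ r μ) x‖ / σ := (one_le_div hσ).2 hlt.le
        rw [min_eq_left (Real.rpow_le_rpow_of_exponent_le h1 (hqp.trans hpr).le)] at hmin
        simpa [hlt, not_le.2 hlt, hcq] using ENNReal.ofReal_le_ofReal hmin
      · have h1 : ‖(T f : Lp B₂ r μ) x‖ / σ ≤ 1 := (div_le_one hσ).2 hle
        rw [min_eq_right (Real.rpow_le_rpow_of_exponent_ge' (by positivity) h1 hq.le
          (hqp.trans hpr).le)] at hmin
        simpa [hle, not_lt.2 hle, hcr] using ENNReal.ofReal_le_ofReal hmin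
    have hm : ∀ (w : Lp B₂ r μ) (e : ℝ), Measurable fun x => ‖w x‖ₑ ^ e := fun w e =>
      (Lp.stronglyMeasurable w).enorm.pow_const e
    have hint := lintegral_mono_ae hpt
    rw [lintegral_add_left (((hm _ q).const_mul _).indicator (measurableSet_lt measurable_const hTfm)),
      lintegral_indicator (measurableSet_lt measurable_const hTfm),
      lintegral_indicator (measurableSet_le hTfm measurable_const),
      lintegral_add_left (((hm _ q).const_mul _).const_mul _),
      lintegral_const_mul _ (hm _ q), lintegral_const_mul _ (hm _ _),
      lintegral_const_mul _ ((hm _ q).const_mul _), lintegral_const_mul _ ((hm _ _).const_mul _),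
      lintegral_const_mul _ (hm _ q), lintegral_const_mul _ (hm _ _)] at hint
    rw [one_mul, one_mul]
    refine hint.trans (add_le_add ?_ ?_)
    · refine (mul_le_mul_right ((mul_le_mul_right hgq _).trans_eq
        (mul_left_comm _ _ _)) _).trans_eq ?_
      rw [ENNReal.ofReal_mul (p := 2 ^ q) (by positivity), mul_assoc (ENNReal.ofReal (2 ^ q))]
    · refine (mul_le_mul_right ((mul_le_mul_right hhr _).trans_eq
        (mul_left_comm _ _ _)) _).trans_eq ?_
      rw [ENNReal.ofReal_mul (p := 2 ^ r.toReal) (by positivity),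
        mul_assoc (ENNReal.ofReal (2 ^ r.toReal))]
  · rw [one_mul, one_mul, ENNReal.ofReal_add (by positivity) (by positivity)]
  · have h4W : 0 < 4 * W := by positivity
    rw [← ENNReal.ofReal_mul (by positivity), ← ENNReal.ofReal_mul (by positivity),
      ← ENNReal.ofReal_add (by positivity) (by positivity)]
    refine ENNReal.ofReal_le_ofReal ?_
    have hs : ∀ e, ((4 * W)⁻¹ * n ^ (1 / (r.toReal - q))) ^ e =
        (4 * W)⁻¹ ^ e * n ^ (1 / (r.toReal - q) * e) := fun e => by
      rw [Real.mul_rpow (by positivity) (by positivity), ← Real.rpow_mul hn.le]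
    rw [hs, hs, ← mul_assoc (2 ^ q), ← Real.mul_rpow zero_le_two (by positivity),
      ← Real.mul_rpow zero_le_two hA.le]
    have e1 : n * n ^ (1 / (r.toReal - q) * (q - p)) = n ^ ((r.toReal - p) / (r.toReal - q)) := by
      conv_lhs => enter [1]; rw [← Real.rpow_one n]
      rw [← Real.rpow_add hn]
      congr 1
      field_simp
      ring
    have e2 : 1 / (r.toReal - q) * (r.toReal - p) = (r.toReal - p) / (r.toReal - q) := by ring
    have h1 : (2 * (2 * W)) ^ q * (4 * W)⁻¹ ^ (q - p) = (4 * W) ^ p := by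
      rw [← rpow_mul_inv_rpow_sub h4W q p]; ring_nf
    have h2 : (2 * A) ^ r.toReal * (4 * W)⁻¹ ^ (r.toReal - p) ≤ (4 * W) ^ p := by
      rw [← rpow_mul_inv_rpow_sub h4W r.toReal p]
      gcongr ?_ ^ _ * _
      linarith
    rw [e2]
    set N := n ^ ((r.toReal - p) / (r.toReal - q)) with hN
    have hN0 : 0 < N := by positivity
    calc (2 * (2 * W)) ^ q * n * ((4 * W)⁻¹ ^ (q - p) * n ^ (1 / (r.toReal - q) * (q - p)) /
            (p - q)) + (2 * A) ^ r.toReal * ((4 * W)⁻¹ ^ (r.toReal - p) * N / (r.toReal - p))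
        = (2 * (2 * W)) ^ q * (4 * W)⁻¹ ^ (q - p) *
            (n * n ^ (1 / (r.toReal - q) * (q - p))) / (p - q) +
          (2 * A) ^ r.toReal * (4 * W)⁻¹ ^ (r.toReal - p) * N / (r.toReal - p) := by ring
      _ ≤ (4 * W) ^ p * N / (p - q) + (4 * W) ^ p * N / (r.toReal - p) := by
          rw [h1, e1]; gcongr
      _ = _ := by ring

/-- Interpolation between strong type `(q, q)` and `L^∞`. -/
theorem lintegral_enorm_apply_rpow_le_of_strong_of_top [SFinite μ]
    {T : LpOn B₁ ∞ μ V →L[ℝ] LpOn B₂ ∞ μ E} (hA : 0 < A) (hAW : A ≤ W)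
    (hstrong : ∀ g : LpOn B₁ ∞ μ V, eLpNorm (T g : Lp B₂ ∞ μ) ∞ μ ≤
      ENNReal.ofReal A * eLpNorm (g : Lp B₁ ∞ μ) ∞ μ)
    {q p n : ℝ} (hq : 0 < q) (hqp : q < p) (hn : 0 < n)
    (hstrong_q : ∀ g : LpOn B₁ ∞ μ V, LpOn.IsBoundedOn E g →
      ∫⁻ x, ‖(T g : Lp B₂ ∞ μ) x‖ₑ ^ q ∂μ ≤
        ENNReal.ofReal ((2 * W) ^ q * n) * ∫⁻ x, ‖(g : Lp B₁ ∞ μ) x‖ₑ ^ q ∂μ)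
    {f : LpOn B₁ ∞ μ V} (hf : LpOn.IsBoundedOn E f) :
    ∫⁻ x, ‖(T f : Lp B₂ ∞ μ) x‖ₑ ^ p ∂μ ≤
      ENNReal.ofReal ((4 * W) ^ p * n) * ∫⁻ x, ‖(f : Lp B₁ ∞ μ) x‖ₑ ^ p ∂μ := by
  have hW : 0 < W := hA.trans_le hAW
  have h1p : 0 < p - q := by linarith
  have hfm := (Lp.stronglyMeasurable (f : Lp B₁ ∞ μ)).norm.measurable
  have hTfm := (Lp.stronglyMeasurable (T f : Lp B₂ ∞ μ)).norm.measurable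
  refine lintegral_rpow_le_of_levels (Lp.stronglyMeasurable _) (Lp.stronglyMeasurable _)
    (q := q) (r := p + 1) (α := 1) (β := 0) (q' := q) (r' := p + 1)
    (α' := ENNReal.ofReal (2 ^ q * ((2 * W) ^ q * n))) (β' := 0)
    (s := (4 * W)⁻¹) (k := 1 / (p - q))
    hq.le hqp (lt_add_one p) hq.le hqp (lt_add_one p) (by positivity) (fun σ hσ => ?_)
    (by positivity) (by simp) ?_
  · obtain ⟨g, h, hfgh, hg, hh⟩ := LpOn.exists_truncation f ((4 * W)⁻¹ * σ)
    have hgq := hstrong_q g (LpOn.IsBoundedOn.of_indicator hf hg)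
    rw [lintegral_enorm_rpow_eq_of_ae_eq_indicator (measurableSet_lt measurable_const hfm) hg hq]
      at hgq
    have hh' : ∀ᵐ x ∂μ, ‖(T h : Lp B₂ ∞ μ) x‖ ≤ A * ((4 * W)⁻¹ * σ) := by
      refine ae_norm_apply_le_of_top hA.le hstrong (by positivity) ?_
      filter_upwards [hh] with x hx
      rw [hx, norm_indicator_eq_indicator_norm]
      exact indicator_le' (fun y hy => hy) (fun _ _ => by positivity) x
    have hsmall : A * ((4 * W)⁻¹ * σ) ≤ σ / 2 :=
      calc A * ((4 * W)⁻¹ * σ) ≤ W * ((4 * W)⁻¹ * σ) := by gcongr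
        _ = σ / 4 := by field_simp
        _ ≤ σ / 2 := by linarith
    have hpt : ∫⁻ x in {x | σ < ‖(T f : Lp B₂ ∞ μ) x‖}, ‖(T f : Lp B₂ ∞ μ) x‖ₑ ^ q ∂μ ≤
        ∫⁻ x, ENNReal.ofReal (2 ^ q) * ‖(T g : Lp B₂ ∞ μ) x‖ₑ ^ q ∂μ := by
      rw [← lintegral_indicator (measurableSet_lt measurable_const hTfm)]
      refine lintegral_mono_ae ?_
      filter_upwards [LpOn.apply_add_ae (T := T) g h, hh'] with x hx hxh
      rw [← hfgh] at hx
      by_cases hlt : σ < ‖(T f : Lp B₂ ∞ μ) x‖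
      · have h1 : ‖(T f : Lp B₂ ∞ μ) x‖ ≤ 2 * ‖(T g : Lp B₂ ∞ μ) x‖ := by
          have := norm_add_le ((T g : Lp B₂ ∞ μ) x) ((T h : Lp B₂ ∞ μ) x)
          rw [← hx] at this
          linarith
        rw [indicator_of_mem (by exact hlt), ← ofReal_norm, ← ofReal_norm,
          ENNReal.ofReal_rpow_of_nonneg (norm_nonneg _) hq.le,
          ENNReal.ofReal_rpow_of_nonneg (norm_nonneg _) hq.le,
          ← ENNReal.ofReal_mul (by positivity), ← Real.mul_rpow zero_le_two (norm_nonneg _)]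
        exact ENNReal.ofReal_le_ofReal (Real.rpow_le_rpow (norm_nonneg _) h1 hq.le)
      · rw [indicator_of_notMem (by exact hlt)]
        exact zero_le
    rw [lintegral_const_mul _ ((Lp.stronglyMeasurable _).enorm.pow_const q)] at hpt
    rw [one_mul, zero_mul, zero_mul, add_zero, add_zero]
    calc _ ≤ ENNReal.ofReal (σ ^ (-q)) * (ENNReal.ofReal (2 ^ q) *
          (ENNReal.ofReal ((2 * W) ^ q * n) *
            ∫⁻ x in {x | (4 * W)⁻¹ * σ < ‖(f : Lp B₁ ∞ μ) x‖}, ‖(f : Lp B₁ ∞ μ) x‖ₑ ^ q ∂μ)) := by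
          gcongr
          exact hpt.trans (by gcongr)
      _ = _ := by
          rw [ENNReal.ofReal_mul (p := 2 ^ q) (by positivity)]
          ring
  · have h4W : 0 < 4 * W := by positivity
    rw [zero_mul, add_zero, ← ENNReal.ofReal_mul (by positivity)]
    refine ENNReal.ofReal_le_ofReal (le_of_eq ?_)
    rw [← mul_assoc (2 ^ q), ← Real.mul_rpow zero_le_two (by positivity),
      ← rpow_mul_inv_rpow_sub h4W q p]
    ring_nf

end Interpolation

/-! ### The interpolation constant -/

section InterpConst

theorem interpConst_self {p : ℝ≥0∞} : 1 ≤ interpConst p p := by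
  rw [interpConst]
  simp

theorem interpConst_term_eq {q p : ℝ} {r : ℝ≥0∞} (hr : r ≠ ∞) (hq : 1 < q) (hqp : q < p)
    (hpr : p < r.toReal) :
    (ENNReal.ofReal q / (ENNReal.ofReal q - 1) + 1 / (r / ENNReal.ofReal q - 1)) ^
        ((1 / ENNReal.ofReal p - 1 / r) / (1 - ENNReal.ofReal q / r)).toReal =
      ENNReal.ofReal ((q / (q - 1) + q / (r.toReal - q)) ^
        ((r.toReal - p) / (p * (r.toReal - q)))) := by
  conv_lhs => rw [← ENNReal.ofReal_toReal hr]
  generalize r.toReal = r at hpr ⊢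
  have h1 : 0 < q - 1 := by linarith
  have h2 : 0 < r - q := by linarith
  have h3 : 0 < r - p := by linarith
  have hq0 : 0 < q := by linarith
  have hp0 : 0 < p := by linarith
  have hr0 : 0 < r := by linarith
  have h4 : 0 < r / q - 1 := by rw [sub_pos, one_lt_div hq0]; linarith
  have h5 : 0 < 1 - q / r := by rw [sub_pos, div_lt_one hr0]; linarith
  have h6 : 0 ≤ 1 / p - 1 / r := by
    rw [sub_nonneg]; exact one_div_le_one_div_of_le hp0 hpr.le
  rw [← ENNReal.ofReal_one, ← ENNReal.ofReal_sub _ zero_le_one, ← ENNReal.ofReal_div_of_pos hq0,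
    ← ENNReal.ofReal_sub _ zero_le_one, ← ENNReal.ofReal_div_of_pos h1,
    ← ENNReal.ofReal_div_of_pos h4, ← ENNReal.ofReal_div_of_pos hp0,
    ← ENNReal.ofReal_div_of_pos hr0, ← ENNReal.ofReal_div_of_pos hr0,
    ← ENNReal.ofReal_sub _ (by positivity), ← ENNReal.ofReal_sub _ (by positivity),
    ← ENNReal.ofReal_div_of_pos h5, ENNReal.toReal_ofReal (by positivity),
    ← ENNReal.ofReal_add (by positivity) (by positivity),
    ENNReal.ofReal_rpow_of_pos (by positivity)]
  congr 2
  · congr 1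
    have : r / q - 1 = (r - q) / q := by field_simp
    rw [this, one_div_div]
  · have e1 : 1 / p - 1 / r = (r - p) / (p * r) := by field_simp
    have e2 : 1 - q / r = (r - q) / r := by field_simp
    rw [e1, e2]
    field_simp

theorem interpConst_term_top_eq {q p : ℝ} (hq : 1 < q) (hqp : q < p) :
    (ENNReal.ofReal q / (ENNReal.ofReal q - 1) + 1 / (∞ / ENNReal.ofReal q - 1)) ^
        ((1 / ENNReal.ofReal p - 1 / ∞) / (1 - ENNReal.ofReal q / ∞)).toReal =
      ENNReal.ofReal ((q / (q - 1)) ^ (1 / p)) := by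
  have h1 : 0 < q - 1 := by linarith
  have hp0 : 0 < p := by linarith
  rw [ENNReal.top_div_of_ne_top ENNReal.ofReal_ne_top, ENNReal.top_sub ENNReal.one_ne_top,
    ENNReal.div_top, ENNReal.div_top, tsub_zero, tsub_zero,
    add_zero, div_one, ← ENNReal.ofReal_one, ← ENNReal.ofReal_sub _ zero_le_one,
    ← ENNReal.ofReal_div_of_pos h1, ← ENNReal.ofReal_div_of_pos hp0,
    ENNReal.toReal_ofReal (by positivity), ENNReal.ofReal_rpow_of_pos (by positivity)]

/-- A bound by every term of the infimum that defines `interpConst` is a bound by the infimum. -/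
theorem le_mul_interpConst_mul {r p a b x : ℝ≥0∞} (hp : 1 < p) (ha0 : a ≠ 0) (ha : a ≠ ∞)
    (hb : b ≠ ∞)
    (h : ∀ q ∈ Ioo 1 p, x ≤
      a * (q / (q - 1) + 1 / (r / q - 1)) ^ ((1 / p - 1 / r) / (1 - q / r)).toReal * b) :
    x ≤ a * interpConst r p * b := by
  rcases eq_or_ne b 0 with rfl | hb0
  · obtain ⟨q, hq⟩ := exists_between hp
    simpa using h q hq
  have hab0 : a * b ≠ 0 := mul_ne_zero ha0 hb0
  have hab : a * b ≠ ∞ := ENNReal.mul_ne_top ha hb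
  rw [mul_right_comm, mul_comm, ← ENNReal.div_le_iff hab0 hab]
  refine le_iInf₂ fun q hq => ?_
  rw [ENNReal.div_le_iff hab0 hab, mul_comm, mul_right_comm]
  exact h q hq

end InterpConst

/-! ### From weak type and strong type to `L^p` -/

section Interpolation

variable {X : Type*} [MeasurableSpace X] {μ : Measure X}
  {B₁ B₂ : Type*} [NormedAddCommGroup B₁] [NormedSpace ℝ B₁]
  [NormedAddCommGroup B₂] [NormedSpace ℝ B₂] {r : ℝ≥0∞} [Fact (1 ≤ r)] {E V : Set X}
  {T : LpOn B₁ r μ V →L[ℝ] LpOn B₂ r μ E} {A W : ℝ}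

/-- Weak type `(1, 1)` and strong type `(r, r)` give the `L^p` bound with the interpolation constant
`interpConst r p`: for each `q ∈ (1, p)`, interpolate first to `L^q`, and then between `L^q` and
`L^r`. -/
theorem eLpNorm_apply_le_interpConst [SFinite μ] (hVm : MeasurableSet V) (hVfin : μ V ≠ ∞)
    (hA : 0 < A) (hAW : A ≤ W)
    (hstrong : ∀ g : LpOn B₁ r μ V, eLpNorm (T g : Lp B₂ r μ) r μ ≤
      ENNReal.ofReal A * eLpNorm (g : Lp B₁ r μ) r μ)
    (hweak : ∀ g : LpOn B₁ r μ V, LpOn.IsBoundedOn E g → ∀ t : ℝ≥0∞,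
      t * μ {x | t < ‖(T g : Lp B₂ r μ) x‖ₑ} ≤
        ENNReal.ofReal W * ∫⁻ x, ‖(g : Lp B₁ r μ) x‖ₑ ∂μ)
    {p : ℝ≥0∞} (hp : 1 < p) (hpr : p < r) {f : LpOn B₁ r μ V} (hf : LpOn.IsBoundedOn E f) :
    eLpNorm (T f : Lp B₂ r μ) p μ ≤
      ENNReal.ofReal (4 * W) * interpConst r p * eLpNorm (f : Lp B₁ r μ) p μ := by
  have hW : 0 < W := hA.trans_le hAW
  refine le_mul_interpConst_mul hp (ENNReal.ofReal_pos.2 (by positivity)).ne'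
    ENNReal.ofReal_ne_top (LpOn.IsBoundedOn.eLpNorm_ne_top hf hVm hVfin p) fun q hq => ?_
  have hptop : p ≠ ∞ := hpr.ne_top
  have hqtop : q ≠ ∞ := hq.2.ne_top
  obtain ⟨p, rfl⟩ : ∃ p₀ : ℝ, p = ENNReal.ofReal p₀ := ⟨_, (ENNReal.ofReal_toReal hptop).symm⟩
  obtain ⟨q, rfl⟩ : ∃ q₀ : ℝ, q = ENNReal.ofReal q₀ := ⟨_, (ENNReal.ofReal_toReal hqtop).symm⟩
  have hq1 : 1 < q := ENNReal.one_lt_ofReal.1 hq.1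
  have hqp : q < p := (ENNReal.ofReal_lt_ofReal_iff_of_nonneg (by linarith)).1 hq.2
  have hp0 : 0 < p := by linarith
  have hq0 : 0 < q := by linarith
  have hq1' : 0 < q - 1 := by linarith
  rcases eq_or_ne r ∞ with rfl | hr
  · rw [interpConst_term_top_eq hq1 hqp]
    refine eLpNorm_le_of_lintegral_rpow_le hp0 (by positivity) (by positivity) ?_
    rw [one_div_mul_cancel hp0.ne', Real.rpow_one]
    exact lintegral_enorm_apply_rpow_le_of_strong_of_top hA hAW hstrong hq0 hqp (by positivity)
      (fun g hg => lintegral_enorm_apply_rpow_le_of_weak_of_top hA hAW hstrong hweak hq1 hg) hf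
  · have hpr' : p < r.toReal := (ENNReal.ofReal_lt_iff_lt_toReal hp0.le hr).1 hpr
    have hqr : 0 < r.toReal - q := by linarith
    rw [interpConst_term_eq hr hq1 hqp hpr']
    refine eLpNorm_le_of_lintegral_rpow_le hp0 (by positivity) (by positivity) ?_
    have he : (r.toReal - p) / (p * (r.toReal - q)) * p = (r.toReal - p) / (r.toReal - q) := by
      field_simp
    rw [he]
    exact lintegral_enorm_apply_rpow_le_of_strong hr hA hAW hstrong hq0 hqp hpr' (by positivity)
      (fun g hg => lintegral_enorm_apply_rpow_le_of_weak hr hA hAW hstrong hweak hq1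
        (hqp.trans hpr') hg) hf

/-- An `L^p` bound for bounded functions extends to all of `L^r`, because the truncations of a
function converge to it in `L^r`, and `L^r` is stronger than `L^p` on sets of finite measure. -/
theorem eLpNorm_apply_le_of_isBoundedOn (hVm : MeasurableSet V) (hVfin : μ V ≠ ∞) (hEV : E ⊆ V)
    (hstrong : ∀ g : LpOn B₁ r μ V, eLpNorm (T g : Lp B₂ r μ) r μ ≤
      ENNReal.ofReal A * eLpNorm (g : Lp B₁ r μ) r μ)
    {p : ℝ≥0∞} (hp : 1 < p) (hpr : p ≤ r) {c : ℝ≥0∞}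
    (hc : ∀ g : LpOn B₁ r μ V, LpOn.IsBoundedOn E g →
      eLpNorm (T g : Lp B₂ r μ) p μ ≤ c * eLpNorm (g : Lp B₁ r μ) p μ)
    {f : LpOn B₁ r μ V} (hf : (f : Lp B₁ r μ) ∈ LpOn B₁ r μ E) :
    eLpNorm (T f : Lp B₂ r μ) p μ ≤ c * eLpNorm (f : Lp B₁ r μ) p μ := by
  set m := μ V ^ (1 / p.toReal - 1 / r.toReal) * ENNReal.ofReal A with hm
  have hmtop : m ≠ ∞ := by
    refine ENNReal.mul_ne_top (ENNReal.rpow_ne_top_of_nonneg ?_ hVfin) ENNReal.ofReal_ne_top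
    have hp0 : 0 < p := zero_lt_one.trans hp
    have := ENNReal.toReal_mono (ENNReal.inv_ne_top.2 hp0.ne') (ENNReal.inv_le_inv.2 hpr)
    rw [ENNReal.toReal_inv, ENNReal.toReal_inv] at this
    simpa [one_div] using this
  have hHolder : ∀ g : LpOn B₁ r μ V,
      eLpNorm (T g : Lp B₂ r μ) p μ ≤ m * eLpNorm (g : Lp B₁ r μ) r μ := by
    intro g
    have hTg : ∀ᵐ x ∂μ, x ∉ E → (T g : Lp B₂ r μ) x = 0 := (T g).2
    have hind : (T g : Lp B₂ r μ) =ᵐ[μ] V.indicator (T g : Lp B₂ r μ) := by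
      filter_upwards [hTg] with x hx
      by_cases hxV : x ∈ V
      · simp [hxV]
      · simp [hxV, hx fun h => hxV (hEV h)]
    rw [eLpNorm_congr_ae hind, eLpNorm_indicator_eq_eLpNorm_restrict hVm]
    refine (eLpNorm_le_eLpNorm_mul_rpow_measure_univ hpr
      (Lp.aestronglyMeasurable (T g : Lp B₂ r μ)).restrict).trans ?_
    rw [Measure.restrict_apply_univ, mul_comm, hm, mul_assoc]
    gcongr
    exact (eLpNorm_mono_measure _ Measure.restrict_le_self).trans (hstrong g)
  have key : ∀ ε : ℝ, 0 < ε → eLpNorm (T f : Lp B₂ r μ) p μ ≤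
      c * eLpNorm (f : Lp B₁ r μ) p μ + m * ENNReal.ofReal ε := by
    intro ε hε
    obtain ⟨M, hM⟩ := (Lp.memLp (f : Lp B₁ r μ)).eLpNorm_indicator_norm_ge_le
      (Lp.stronglyMeasurable _) hε
    obtain ⟨g, h, hfgh, hg, hh⟩ := LpOn.exists_truncation f M
    have hgε : eLpNorm (g : Lp B₁ r μ) r μ ≤ ENNReal.ofReal ε := by
      rw [eLpNorm_congr_ae hg]
      refine le_trans (eLpNorm_mono fun x => norm_indicator_le_of_subset ?_ _ x) hM
      exact fun y (hy : M < ‖(f : Lp B₁ r μ) y‖) => hy.le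
    have hhb : LpOn.IsBoundedOn E h := by
      refine ⟨LpOn.mem_of_ae_eq_indicator hf hh, max M 0, ?_⟩
      filter_upwards [hh] with x hx
      rw [hx, norm_indicator_eq_indicator_norm]
      exact indicator_le' (fun y hy => le_max_of_le_left hy) (fun _ _ => le_max_right _ _) x
    have hhf : eLpNorm (h : Lp B₁ r μ) p μ ≤ eLpNorm (f : Lp B₁ r μ) p μ := by
      rw [eLpNorm_congr_ae hh]
      exact eLpNorm_indicator_le _
    have hT : (T f : Lp B₂ r μ) =ᵐ[μ] fun x => (T h : Lp B₂ r μ) x + (T g : Lp B₂ r μ) x := by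
      rw [hfgh, add_comm]
      exact LpOn.apply_add_ae h g
    rw [eLpNorm_congr_ae hT]
    refine (eLpNorm_add_le (Lp.aestronglyMeasurable _) (Lp.aestronglyMeasurable _) hp.le).trans ?_
    gcongr
    · exact (hc h hhb).trans (by gcongr)
    · exact (hHolder g).trans (by gcongr)
  have hlim : Filter.Tendsto
      (fun ε : ℝ => c * eLpNorm (f : Lp B₁ r μ) p μ + m * ENNReal.ofReal ε)
      (nhdsWithin 0 (Ioi 0)) (nhds (c * eLpNorm (f : Lp B₁ r μ) p μ + m * ENNReal.ofReal 0)) := by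
    refine Filter.Tendsto.mono_left ?_ nhdsWithin_le_nhds
    exact tendsto_const_nhds.add (ENNReal.Tendsto.const_mul
      (ENNReal.continuous_ofReal.tendsto 0) (Or.inr hmtop))
  rw [ENNReal.ofReal_zero, mul_zero, add_zero] at hlim
  refine ge_of_tendsto hlim ?_
  filter_upwards [self_mem_nhdsWithin] with ε hε
  exact key ε hε

end Interpolation

/-! ### The `L^p` bound -/

theorem theorem14
    {X : Type*} [MetricSpace X] [LocallyCompactSpace X] [ConnectedSpace X]
    [MeasurableSpace X] [BorelSpace X]
    (μ : Measure X) [μ.InnerRegular] [IsLocallyFiniteMeasure μ] [μ.IsOpenPosMeasure]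
    {B₁ B₂ : Type*} [NormedAddCommGroup B₁] [NormedSpace ℝ B₁] [CompleteSpace B₁]
    [NormedAddCommGroup B₂] [NormedSpace ℝ B₂] [CompleteSpace B₂]
    (R : ℝ) (hR : 0 < R) (κ : ℝ) (hκ : 2 < κ)
    (hD : doublingConst μ (3 * κ * R) < ∞)
    (r : ℝ≥0∞) [Fact (1 ≤ r)] (hr : 1 < r)
    (E : Set X) (hE : NullMeasurableSet E μ) (hdiam : ediam E < ENNReal.ofReal R)
    (T : LpOn B₁ r μ (thickening (R / 2) E) →L[ℝ] LpOn B₂ r μ E)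
    (K : X → X → B₁ →L[ℝ] B₂)
    (hK : AEStronglyMeasurable (Function.uncurry K)
      ((μ.restrict E).prod (μ.restrict (thickening (R / 2) E))))
    (h_i : HasKernelOffDiagonal μ R r E T K)
    (A : ℝ) (hA : 0 < A) (h_ii : ∀ f, ‖T f‖ ≤ A * ‖f‖)
    (C : ℝ) (hC : 0 < C) (h_iii : HormanderCondition μ R E K C)
    (p : ℝ≥0∞) (hp : 1 < p) (hpr : p ≤ r)
    (f : LpOn B₁ r μ (thickening (R / 2) E)) (hf : (f : Lp B₁ r μ) ∈ LpOn B₁ r μ E) :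
    eLpNorm (T f : Lp B₂ r μ) p μ ≤
      16 * interpConst r p *
        (doublingConst μ (3 * κ * R) ^ 9 * ENNReal.ofReal A + ENNReal.ofReal C) *
        eLpNorm (f : Lp B₁ r μ) p μ := by
  set D := doublingConst μ (3 * κ * R) with hDdef
  have hD1 : 1 ≤ D := one_le_doublingConst
  have hL : 0 < 3 * κ * R := by positivity
  have hLR : 6 * R < 3 * κ * R := by nlinarith
  have hball : ∀ x, μ (ball x (2 * (3 * κ * R))) < ∞ := measure_ball_lt_top_of_doubling hL hD
  have : SecondCountableTopology X := secondCountableTopology_of_measure_ball_lt_top hL hball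
  have : IsUnifLocDoublingMeasure μ := isUnifLocDoublingMeasure_of_doublingConst_lt_top hL hD
  have hdist : ∀ x ∈ E, ∀ y ∈ E, dist x y ≤ R := by
    intro x hx y hy
    have h := (edist_le_ediam_of_mem hx hy).trans hdiam.le
    rwa [edist_dist, ENNReal.ofReal_le_ofReal_iff hR.le] at h
  have hVfin : μ (thickening (R / 2) E) ≠ ∞ := by
    rcases E.eq_empty_or_nonempty with rfl | ⟨x, hx⟩
    · simp
    refine ne_top_of_le_ne_top (hball x).ne (measure_mono fun y hy => ?_)
    obtain ⟨z, hz, hyz⟩ := mem_thickening_iff.1 hy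
    rw [mem_ball]
    linarith [dist_triangle y z x, hdist z hz x hx]
  have hVm : MeasurableSet (thickening (R / 2) E) := isOpen_thickening.measurableSet
  have hEV : E ⊆ thickening (R / 2) E := self_subset_thickening (by positivity) E
  set N := D ^ 9 * ENNReal.ofReal A + ENNReal.ofReal C with hN
  have hAN : ENNReal.ofReal A ≤ N :=
    (le_mul_of_one_le_left zero_le (one_le_pow₀ hD1)).trans le_self_add
  have hNtop : N ≠ ∞ := by simp [hN, ENNReal.mul_eq_top, hD.ne]
  have hANr : A ≤ N.toReal := (ENNReal.ofReal_le_iff_le_toReal hNtop).1 hAN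
  have hstrong := eLpNorm_apply_le_of_norm_le hA.le h_ii
  have hweak : ∀ g : LpOn B₁ r μ (thickening (R / 2) E), LpOn.IsBoundedOn E g → ∀ t : ℝ≥0∞,
      t * μ {x | t < ‖(T g : Lp B₂ r μ) x‖ₑ} ≤
        ENNReal.ofReal (4 * N.toReal) * ∫⁻ x, ‖(g : Lp B₁ r μ) x‖ₑ ∂μ := by
    intro g hg t
    obtain ⟨hgE, M, hM⟩ := hg
    rw [ENNReal.ofReal_mul (by norm_num), ENNReal.ofReal_toReal hNtop, ENNReal.ofReal_ofNat]
    exact mul_measure_lt_enorm_apply_le hR hD1 hD.ne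
      (fun x ρ n h0 h => measure_closedBall_two_pow_mul_le hD x h0 n (by linarith))
      hdist hVfin hK h_i hA h_ii h_iii hgE hM t
  rcases hpr.eq_or_lt with rfl | hpr'
  · calc eLpNorm (T f : Lp B₂ p μ) p μ
        ≤ 1 * 1 * ENNReal.ofReal A * eLpNorm (f : Lp B₁ p μ) p μ := by
          rw [one_mul, one_mul]; exact hstrong f
      _ ≤ 16 * interpConst p p * N * eLpNorm (f : Lp B₁ p μ) p μ := by
          gcongr
          · norm_num
          · exact interpConst_self
  · refine eLpNorm_apply_le_of_isBoundedOn hVm hVfin hEV hstrong hp hpr (fun g hg => ?_) hf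
    refine (eLpNorm_apply_le_interpConst hVm hVfin hA (W := 4 * N.toReal) (by linarith) hstrong
      hweak hp hpr' hg).trans_eq ?_
    rw [← mul_assoc, ENNReal.ofReal_mul (by norm_num), ENNReal.ofReal_toReal hNtop,
      show (4 : ℝ) * 4 = 16 by norm_num, ENNReal.ofReal_ofNat]
    ring
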